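/- Fix $\sigma>0$, costs $c_{\mathsf{FA}},c_{\mathsf{MD}}>0$ and a prior $\mathbb P[H=0]=\pi_0\in(0,1)$, $\mathbb P[H=1]=1-\pi_0$. For every $N$ consider a star network with $N$ local agents $1,\dots,N$ and a fusion agent $0$. Agent $i\in\{0,\dots,N\}$ observes $Y_i=H+Z_i$, where $Z_0,\dots,Z_N$ are i.i.d. $\mathcal N(0,\sigma^2)$ and independent of $H$. Local agent $i$ makes a decision $\widehat H_i\in\{0,1\}$ from $Y_i$, and the fusion agent makes a decision $\widehat H_0\in\{0,1\}$ from $(Y_0,\widehat H_1,\dots,\widehat H_N)$. The Bayes risk of the fusion agent is $$R_0^{(N)}=c_{\mathsf{FA}}\,\pi_0\,\mathbb P[\widehat H_0=1\mid H=0]+c_{\mathsf{MD}}\,(1-\pi_0)\,\mathbb P[\widehat H_0=0\mid H=1].$$ The optimal risk exponent is $$\beta^*=\sup\Big(-\lim_{N\to\infty}\tfrac1N\log R_0^{(N)}\Big),$$ where the supremum is over all families (indexed by $N$) of decision rules of the local agents and the fusion agent for which the limit exists; the rules may be randomized (independently across the agents), need not be identical, and may depend on $N$. An agent may hold a belief in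 $(0,1)$, its perceived value of $\mathbb P[H=0]$. Write $f(\cdot|h)$ for the density of $\mathcal N(h,\sigma^2)$. A local agent with belief $q$ decides $1$ if and only if $$\frac{f(y|1)}{f(y|0)}>\frac{c_{\mathsf{FA}}\,q}{c_{\mathsf{MD}}(1-q)};$$ let $p_q(\cdot|h)$ be the law of its decision given $H=h$. The fusion agent with belief $q_0$ acts as if $q_0$ were the true prior and every local agent had the belief $q_0$: having observed $y_0,\hat h_1,\dots,\hat h_N$, it decides $1$ if and only if $$\frac{f(y_0|1)}{f(y_0|0)}>\frac{c_{\mathsf{FA}}\,q_0}{c_{\mathsf{MD}}(1-q_0)}\prod_{i=1}^N\frac{p_{q_0}(\hat h_i|0)}{p_{q_0}(\hat h_i|1)}.$$ Then, for the belief $q^*=\frac{c_{\mathsf{MD}}}{c_{\mathsf{FA}}+c_{\mathsf{MD}}}$: 1. A local agent with belief $q^*$ decides $1$ exactly when $y>\tfrac12$. 2. If all agents $0,1,\dots,N$ have the belief $q^*$, the risk $R_0^{(N)}$ is minimized asymptotically in the sense of the risk exponent: $-\frac1N\log R_0^{(N)}\to\beta^*$ as $N\to\infty$, whereas every family of decision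 rules satisfies $\limsup_{N\to\infty}-\frac1N\log R_0^{(N)}\le\beta^*$. 3. $\beta^*=C\big(\mathsf{Bern}(Q(0.5/\sigma)),\mathsf{Bern}(Q(-0.5/\sigma))\big)$, where $Q(x)=\int_x^\infty\frac{1}{\sqrt{2\pi}}e^{-t^2/2}\,dt$, $\mathsf{Bern}(p)$ is the law on $\{0,1\}$ with mass $p$ at $1$, and $C(p_1,p_2)=-\min_{s\in[0,1]}\log\sum_x p_1(x)^s\,p_2(x)^{1-s}$ is the Chernoff information. 4. If $\sigma=1$, then $\beta^*=0.0793$ up to an error smaller than $5\cdot10^{-5}$. -/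

import Mathlib

open MeasureTheory ProbabilityTheory Filter Topology
open scoped NNReal

noncomputable section

namespace StarNetwork

/-! Hypotheses and decisions are Booleans: `false` stands for `0` and `true` for `1`. -/

/-- The value `0` or `1` of the hypothesis as a real number. -/
def hypValue (h : Bool) : ℝ := if h then 1 else 0

/-- The law of a private signal `Y = H + Z`, `Z ∼ N(0, σ²)`, given `H = h`. -/
def signalLaw (σ : ℝ≥0) (h : Bool) : Measure ℝ := gaussianReal (hypValue h) (σ ^ 2)

instance (σ : ℝ≥0) (h : Bool) : IsProbabilityMeasure (signalLaw σ h) := by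
  unfold signalLaw; infer_instance

/-- The conditional density `f_{Y|H}(y|h)` of a private signal. -/
def signalPDF (σ : ℝ≥0) (h : Bool) (y : ℝ) : ℝ := gaussianPDFReal (hypValue h) (σ ^ 2) y

/-- The likelihood ratio `f_{Y|H}(y|1) / f_{Y|H}(y|0)` of a private signal. -/
def likelihoodRatio (σ : ℝ≥0) (y : ℝ) : ℝ := signalPDF σ true y / signalPDF σ false y

/-- Arbitrary decision rules, possibly randomized, for a star network with `N` local agents:
each local agent sees its private signal, and the fusion agent sees its own private signal
together with all the local decisions. The rules are not required to be identical, to be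
likelihood ratio tests, or to be selfish. -/
structure DecisionRules (N : ℕ) where
  /-- decision rules of the local agents -/
  loc : Fin N → Kernel ℝ Bool
  /-- decision rule of the fusion agent -/
  fus : Kernel (ℝ × (Fin N → Bool)) Bool
  loc_markov : ∀ i, IsMarkovKernel (loc i)
  fus_markov : IsMarkovKernel fus

/-- The law `p_{Ĥᵢ|H}(· | h)` of the decision of a local agent that uses the rule `κ`. -/
def localLaw (σ : ℝ≥0) (κ : Kernel ℝ Bool) (h : Bool) : Measure Bool :=
  κ ∘ₘ signalLaw σ h

/-- The law `p_{Ĥ₀|H}(· | h)` of the decision of the fusion agent. Given `H = h`, its own private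
signal and the local decisions are independent. -/
def fusionLaw (σ : ℝ≥0) {N : ℕ} (D : DecisionRules N) (h : Bool) : Measure Bool :=
  D.fus ∘ₘ ((signalLaw σ h).prod (Measure.pi fun i => localLaw σ (D.loc i) h))

/-- The true Bayes risk `R₀ = c_FA π₀ p_{Ĥ₀|H}(1|0) + c_MD (1 - π₀) p_{Ĥ₀|H}(0|1)` of the
fusion agent. -/
def bayesRisk (σ : ℝ≥0) (cFA cMD π₀ : ℝ) {N : ℕ} (D : DecisionRules N) : ℝ :=
  cFA * π₀ * (fusionLaw σ D false).real {true}
    + cMD * (1 - π₀) * (fusionLaw σ D true).real {false}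

/-- The quantity `-(1/N) log R₀^(N)` for a network with `N` local agents. -/
def riskRate (σ : ℝ≥0) (cFA cMD π₀ : ℝ) {N : ℕ} (D : DecisionRules N) : ℝ :=
  -(1 / (N : ℝ)) * Real.log (bayesRisk σ cFA cMD π₀ D)

/-- The optimal risk exponent `β* = sup (- lim (1/N) log R₀^(N))`, the supremum being over all
families of decision rules for which the limit exists (in the extended reals). -/
def optimalRiskExponent (σ : ℝ≥0) (cFA cMD π₀ : ℝ) : EReal :=
  sSup {β : EReal | ∃ D : ∀ N : ℕ, DecisionRules N,
    Tendsto (fun N => (riskRate σ cFA cMD π₀ (D N) : EReal)) atTop (𝓝 β)}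

/-! ### Selfish decisions based on beliefs -/

/-- Decision of a local agent with belief `q` (its perceived value of `P[H = 0]`): the likelihood
ratio test with threshold `c_FA q / (c_MD (1 - q))`. -/
def localDecision (σ : ℝ≥0) (cFA cMD q : ℝ) (y : ℝ) : Bool :=
  if cFA * q / (cMD * (1 - q)) < likelihoodRatio σ y then true else false

lemma measurable_likelihoodRatio (σ : ℝ≥0) : Measurable (likelihoodRatio σ) :=
  (measurable_gaussianPDFReal _ _).div (measurable_gaussianPDFReal _ _)

lemma measurable_localDecision (σ : ℝ≥0) (cFA cMD q : ℝ) :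
    Measurable (localDecision σ cFA cMD q) :=
  Measurable.ite (measurableSet_lt measurable_const (measurable_likelihoodRatio σ))
    measurable_const measurable_const

/-- The rule `localDecision` as a (deterministic) kernel. -/
def localKernel (σ : ℝ≥0) (cFA cMD q : ℝ) : Kernel ℝ Bool :=
  Kernel.deterministic (localDecision σ cFA cMD q) (measurable_localDecision σ cFA cMD q)

/-- Decision of the fusion agent with belief `q₀`: the likelihood ratio test for `(y₀, ĥ₁, …, ĥ_N)`
that it performs when it thinks that `q₀` is the true prior and that every local agent has the
belief `q₀` too. -/
def fusionDecision (σ : ℝ≥0) (cFA cMD q₀ : ℝ) {N : ℕ} (x : ℝ × (Fin N → Bool)) : Bool :=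
  if cFA * q₀ / (cMD * (1 - q₀)) *
      ∏ i, ((localLaw σ (localKernel σ cFA cMD q₀) false).real {x.2 i} /
        (localLaw σ (localKernel σ cFA cMD q₀) true).real {x.2 i})
      < likelihoodRatio σ x.1
  then true else false

lemma measurable_fusionDecision (σ : ℝ≥0) (cFA cMD q₀ : ℝ) (N : ℕ) :
    Measurable (fusionDecision σ cFA cMD q₀ (N := N)) := by
  have h : Measurable fun ĥ : Fin N → Bool => cFA * q₀ / (cMD * (1 - q₀)) *
      ∏ i, ((localLaw σ (localKernel σ cFA cMD q₀) false).real {ĥ i} /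
        (localLaw σ (localKernel σ cFA cMD q₀) true).real {ĥ i}) := .of_discrete
  exact Measurable.ite (measurableSet_lt (h.comp measurable_snd)
    ((measurable_likelihoodRatio σ).comp measurable_fst)) measurable_const measurable_const

/-- The decision rules of a network in which the fusion agent has the belief `q₀` and the `i`-th
local agent has the belief `q i`. -/
def beliefRules (σ : ℝ≥0) (cFA cMD : ℝ) {N : ℕ} (q₀ : ℝ) (q : Fin N → ℝ) : DecisionRules N where
  loc i := localKernel σ cFA cMD (q i)
  fus := Kernel.deterministic (fusionDecision σ cFA cMD q₀)
    (measurable_fusionDecision σ cFA cMD q₀ N)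
  loc_markov i := by unfold localKernel; infer_instance
  fus_markov := inferInstance

/-! ### Chernoff information -/

/-- The complementary distribution function `Q` of the standard Gaussian distribution. -/
def gaussianQ (x : ℝ) : ℝ := ∫ t in Set.Ioi x, gaussianPDFReal 0 1 t

lemma gaussianQ_mem (x : ℝ) : gaussianQ x ∈ unitInterval := by
  refine ⟨setIntegral_nonneg measurableSet_Ioi fun t _ => gaussianPDFReal_nonneg _ _ _, ?_⟩
  rw [← integral_gaussianPDFReal_eq_one 0 (one_ne_zero (α := ℝ≥0))]
  exact setIntegral_le_integral (integrable_gaussianPDFReal _ _)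
    (.of_forall fun t => gaussianPDFReal_nonneg _ _ _)

/-- `Bern(Q(x))`, as a measure on `Bool` that gives mass `Q(x)` to `true`. -/
def bernQ (x : ℝ) : Measure Bool := bernoulliMeasure true false ⟨gaussianQ x, gaussianQ_mem x⟩

/-- Chernoff information `-min_{s ∈ [0,1]} log (∑ₓ p₁(x)^s p₂(x)^(1-s))` of two distributions of
full support on a finite set (the minimum of a continuous function on `[0,1]`). -/
def chernoffInfo {X : Type*} [Fintype X] [MeasurableSpace X] (p₁ p₂ : Measure X) : ℝ :=
  -sInf ((fun s : ℝ => Real.log (∑ x, p₁.real {x} ^ s * p₂.real {x} ^ (1 - s))) '' Set.Icc 0 1)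

end StarNetwork

end

noncomputable section

namespace StarNetwork

/-! ### The standard Gaussian distribution -/

/-! Write Φ = `stdCDF`, h = `halfDist σ` = 1/(2σ) and ψ = `symExponent h` = -log (2 √(Φ(h) Φ(-h))).
All claims about the exponent reduce to the statement that it equals ψ.

Achievability. With the belief q* the cost threshold is 1, so local agents cut at 1/2 and the fusion
agent runs a maximum likelihood test. Each of its two error probabilities is at most ∑ₓ min(P₀(x),
P₁(x)), the sum being over the vectors of local decisions, and min ≤ geometric mean bounds this by
(∑_b √(p₀(b) p₁(b)))^N = e^{-Nψ} (`bayesRisk_beliefRules_le`).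

Converse (`le_bayesRisk`). The private signal of the fusion agent improves the risk by at most a
constant factor, so a lower bound for ∑ₓ min(P₀(x), P₁(x)) suffices. For each local agent there is a
Bernoulli law whose relative entropies to both laws of its decision are at most ψ (`exists_tilt`).
Under the product of these laws both log-likelihood ratios have mean at most Nψ and fluctuations
O(√N), uniformly in the rules, and a change of measure gives the overlap bound exp(-Nψ - O(√N)).
Since the law is chosen agent by agent, non-identical rules cause no trouble.

The tilted law. The Neyman–Pearson lemma reduces a binary quantization to a threshold test, with
Bernoulli parameters Φ(u - h) and Φ(u + h). The Bernoulli law at equal relative entropy from both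
has the Chernoff information `shiftExponent h u` as this common value. The analytic heart is
`shiftExponent_le`: it is largest at u = 0, where it equals ψ.

In terms of the log-odds θ = `cdfLogit`, `symExponent` is log cosh(θ/2), the Bernoulli log-partition
function up to a constant, and the equidistant law is given by the slope of a chord of this
function. The derivative of `shiftExponent h` is nonpositive for u > 0 by two facts: the ratio of
the derivative of `symExponent` to `cdfLogit` decreases on (0, ∞), and an inequality between
products of quotients sinh z / z holds, which is convexity of cosh √w. The first fact rests on
`cdfDev_mul_logitDeriv_sq_le`, proved by Taylor bounds for x² ≤ 4/3 and by Birnbaum's tail bound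
beyond. -/

/-- The standard Gaussian density. -/
def stdPDF (x : ℝ) : ℝ := gaussianPDFReal 0 1 x

/-- The standard Gaussian distribution function. -/
def stdCDF (x : ℝ) : ℝ := gaussianQ (-x)

lemma stdPDF_eq (x : ℝ) : stdPDF x = (√(2 * Real.pi))⁻¹ * Real.exp (-x ^ 2 / 2) := by
  simp [stdPDF, gaussianPDFReal]

lemma stdPDF_pos (x : ℝ) : 0 < stdPDF x := gaussianPDFReal_pos _ _ _ one_ne_zero

lemma stdPDF_neg (x : ℝ) : stdPDF (-x) = stdPDF x := by simp [stdPDF_eq]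

lemma hasDerivAt_stdPDF (x : ℝ) : HasDerivAt stdPDF (-x * stdPDF x) x := by
  have h : HasDerivAt (fun y : ℝ => (√(2 * Real.pi))⁻¹ * Real.exp (-y ^ 2 / 2))
      ((√(2 * Real.pi))⁻¹ * (Real.exp (-x ^ 2 / 2) * (-(2 * x) / 2))) x := by
    have h1 : HasDerivAt (fun y : ℝ => -y ^ 2 / 2) (-(2 * x) / 2) x := by
      simpa using ((hasDerivAt_pow 2 x).neg).div_const 2
    exact h1.exp.const_mul _
  rw [funext stdPDF_eq]
  convert h using 1
  ring

lemma continuous_stdPDF : Continuous stdPDF :=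
  continuous_iff_continuousAt.2 fun x => (hasDerivAt_stdPDF x).continuousAt

lemma integrable_stdPDF : Integrable stdPDF := integrable_gaussianPDFReal 0 1

lemma gaussianQ_add_gaussianQ_neg (x : ℝ) : gaussianQ x + gaussianQ (-x) = 1 := by
  have h1 : gaussianQ (-x) = ∫ t in Set.Iic x, stdPDF t := by
    rw [gaussianQ, ← integral_comp_neg_Iic]
    exact integral_congr_ae (.of_forall fun t => (stdPDF_neg t))
  rw [h1, add_comm]
  have := intervalIntegral.integral_Iic_add_Ioi (b := x) (f := stdPDF) (μ := volume)
    integrable_stdPDF.integrableOn integrable_stdPDF.integrableOn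
  exact this.trans (integral_gaussianPDFReal_eq_one 0 one_ne_zero)

lemma stdCDF_add_neg (x : ℝ) : stdCDF x + stdCDF (-x) = 1 := by
  simpa [stdCDF] using gaussianQ_add_gaussianQ_neg (-x)

lemma stdCDF_neg (x : ℝ) : stdCDF (-x) = 1 - stdCDF x := by linarith [stdCDF_add_neg x]

lemma stdCDF_zero : stdCDF 0 = 1 / 2 := by
  have := stdCDF_add_neg 0
  rw [neg_zero] at this
  linarith

lemma stdCDF_sub_half (x : ℝ) : stdCDF x = 1 / 2 + ∫ t in (0 : ℝ)..x, stdPDF t := by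
  have h1 : ∀ y, gaussianQ y = gaussianQ 0 - ∫ t in (0 : ℝ)..y, stdPDF t := by
    intro y
    rw [← intervalIntegral.integral_Ioi_sub_Ioi' (f := stdPDF) (μ := volume)
      integrable_stdPDF.integrableOn integrable_stdPDF.integrableOn]
    simp [gaussianQ, stdPDF]
  have h2 : gaussianQ 0 = 1 / 2 := by simpa [stdCDF] using stdCDF_zero
  have h3 := stdCDF_neg (-x)
  rw [neg_neg] at h3
  rw [h3, stdCDF, neg_neg, h1, h2]
  ring

lemma hasDerivAt_stdCDF (x : ℝ) : HasDerivAt stdCDF (stdPDF x) x := by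
  rw [funext stdCDF_sub_half]
  exact (continuous_stdPDF.integral_hasStrictDerivAt 0 x).hasDerivAt.const_add _

lemma continuous_stdCDF : Continuous stdCDF :=
  continuous_iff_continuousAt.2 fun x => (hasDerivAt_stdCDF x).continuousAt

lemma stdCDF_strictMono : StrictMono stdCDF :=
  strictMono_of_deriv_pos fun x => by rw [(hasDerivAt_stdCDF x).deriv]; exact stdPDF_pos x

lemma stdCDF_pos (x : ℝ) : 0 < stdCDF x :=
  lt_of_le_of_lt (gaussianQ_mem _).1 (stdCDF_strictMono (sub_one_lt x))

lemma stdCDF_lt_one (x : ℝ) : stdCDF x < 1 := by linarith [stdCDF_pos (-x), stdCDF_add_neg x]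

lemma tendsto_stdCDF_atTop : Tendsto stdCDF atTop (𝓝 1) := by
  have h := intervalIntegral_tendsto_integral_Ioi (0 : ℝ) (f := stdPDF) (μ := volume)
    integrable_stdPDF.integrableOn tendsto_id
  have h2 : ∫ t in Set.Ioi (0 : ℝ), stdPDF t = 1 / 2 := by
    simpa [stdCDF, gaussianQ, stdPDF] using stdCDF_zero
  rw [h2] at h
  have h3 := h.const_add (1 / 2)
  norm_num at h3
  refine h3.congr fun x => ?_
  rw [stdCDF_sub_half]

lemma tendsto_stdPDF_atTop : Tendsto stdPDF atTop (𝓝 0) := by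
  rw [funext stdPDF_eq, ← mul_zero (√(2 * Real.pi))⁻¹]
  refine Tendsto.const_mul _ (Real.tendsto_exp_atBot.comp ?_)
  have : Tendsto (fun x : ℝ => x ^ 2 / 2) atTop atTop :=
    (tendsto_pow_atTop two_ne_zero).atTop_div_const two_pos
  exact (tendsto_neg_atTop_atBot.comp this).congr fun x => (neg_div _ _).symm

/-- Birnbaum's lower bound for the Gaussian tail. -/
lemma birnbaum_le (x : ℝ) : stdPDF x * ((√(x ^ 2 + 4) - x) / 2) ≤ stdCDF (-x) := by
  set F : ℝ → ℝ := fun x => stdCDF (-x) - stdPDF x * ((√(x ^ 2 + 4) - x) / 2) with hF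
  have hd : ∀ x, HasDerivAt F (-stdPDF x - (-x * stdPDF x * ((√(x ^ 2 + 4) - x) / 2)
      + stdPDF x * ((x / √(x ^ 2 + 4) - 1) / 2))) x := by
    intro x
    have h1 : HasDerivAt (fun x => stdCDF (-x)) (-stdPDF x) x := by
      rw [funext stdCDF_neg]
      exact (hasDerivAt_stdCDF x).const_sub 1
    have h2 : HasDerivAt (fun x : ℝ => √(x ^ 2 + 4)) (x / √(x ^ 2 + 4)) x := by
      have h : HasDerivAt (fun x : ℝ => x ^ 2 + 4) (2 * x) x := by
        simpa using (hasDerivAt_pow 2 x).add_const 4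
      convert h.sqrt (by positivity) using 1
      field_simp
    exact h1.sub ((hasDerivAt_stdPDF x).mul ((h2.sub (hasDerivAt_id x)).div_const 2))
  have hanti : Antitone F := by
    refine antitone_of_deriv_nonpos (fun x => (hd x).differentiableAt) fun x => ?_
    rw [(hd x).deriv]
    have hp := stdPDF_pos x
    set q := √(x ^ 2 + 4) with hq
    have hq0 : 0 < q := by positivity
    have hq2 : q ^ 2 = x ^ 2 + 4 := Real.sq_sqrt (by positivity)
    -- The squares of the two sides differ by exactly 4.
    have key : x * (x ^ 2 + 3) ≤ (1 + x ^ 2) * q := by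
      refine (le_abs_self _).trans (abs_le_of_sq_le_sq ?_ (by positivity))
      rw [mul_pow, mul_pow, hq2]
      nlinarith [sq_nonneg x]
    have : -stdPDF x - (-x * stdPDF x * ((q - x) / 2) + stdPDF x * ((x / q - 1) / 2))
        = stdPDF x / (2 * q) * (x * (q ^ 2 - 1) - (1 + x ^ 2) * q) := by
      field_simp
      ring
    rw [this, hq2]
    apply mul_nonpos_of_nonneg_of_nonpos (by positivity)
    linarith
  have hlim : Tendsto F atTop (𝓝 0) := by
    have h1 : Tendsto (fun x => stdCDF (-x)) atTop (𝓝 0) := by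
      have := tendsto_stdCDF_atTop.const_sub 1
      simpa [stdCDF_neg] using this
    have h2 : Tendsto (fun x => stdPDF x * ((√(x ^ 2 + 4) - x) / 2)) atTop (𝓝 0) := by
      refine squeeze_zero' ?_ ?_ tendsto_stdPDF_atTop
      · refine .of_forall fun x => mul_nonneg (stdPDF_pos x).le ?_
        have : x ≤ √(x ^ 2 + 4) := Real.le_sqrt_of_sq_le (by linarith)
        linarith
      · filter_upwards [eventually_ge_atTop 0] with x hx
        have : √(x ^ 2 + 4) ≤ x + 2 := Real.sqrt_le_iff.2 ⟨by linarith, by nlinarith⟩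
        nlinarith [stdPDF_pos x]
    simpa using h1.sub h2
  have := hanti.le_of_tendsto hlim x
  simp only [hF] at this
  linarith

/-! ### The log-odds of the standard Gaussian distribution function -/

/-- The deviation of the standard Gaussian distribution function from `1/2`. -/
def cdfDev (x : ℝ) : ℝ := stdCDF x - 1 / 2

/-- The derivative of the log-odds of the standard Gaussian distribution function. -/
def logitDeriv (x : ℝ) : ℝ := stdPDF x / (stdCDF x * stdCDF (-x))

/-- The log-odds of the standard Gaussian distribution function. -/
def cdfLogit (x : ℝ) : ℝ := Real.log (stdCDF x) - Real.log (stdCDF (-x))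

/-- The Chernoff information between the Bernoulli laws with parameters `stdCDF x` and
`stdCDF (-x)`. -/
def symExponent (x : ℝ) : ℝ :=
  -(1 / 2) * (Real.log (stdCDF x) + Real.log (stdCDF (-x))) - Real.log 2

lemma hasDerivAt_stdCDF_neg (x : ℝ) : HasDerivAt (fun x => stdCDF (-x)) (-stdPDF x) x := by
  rw [funext stdCDF_neg]
  exact (hasDerivAt_stdCDF x).const_sub 1

lemma logitDeriv_pos (x : ℝ) : 0 < logitDeriv x :=
  div_pos (stdPDF_pos x) (mul_pos (stdCDF_pos x) (stdCDF_pos (-x)))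

lemma logitDeriv_neg (x : ℝ) : logitDeriv (-x) = logitDeriv x := by
  rw [logitDeriv, logitDeriv, neg_neg, stdPDF_neg, mul_comm (stdCDF (-x))]

lemma cdfLogit_neg (x : ℝ) : cdfLogit (-x) = -cdfLogit x := by simp [cdfLogit]

lemma cdfLogit_zero : cdfLogit 0 = 0 := by simp [cdfLogit]

lemma symExponent_neg (x : ℝ) : symExponent (-x) = symExponent x := by
  simp [symExponent, add_comm]

lemma cdfDev_neg (x : ℝ) : cdfDev (-x) = -cdfDev x := by
  rw [cdfDev, cdfDev, stdCDF_neg]; ring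

lemma cdfDev_zero : cdfDev 0 = 0 := by simp [cdfDev, stdCDF_zero]

lemma hasDerivAt_cdfDev (x : ℝ) : HasDerivAt cdfDev (stdPDF x) x :=
  (hasDerivAt_stdCDF x).sub_const _

lemma cdfDev_strictMono : StrictMono cdfDev := fun _ _ h =>
  sub_lt_sub_right (stdCDF_strictMono h) _

lemma cdfDev_pos {x : ℝ} (hx : 0 < x) : 0 < cdfDev x := by
  simpa [cdfDev_zero] using cdfDev_strictMono hx

lemma stdCDF_mul_neg (x : ℝ) : stdCDF x * stdCDF (-x) = 1 / 4 - cdfDev x ^ 2 := by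
  rw [cdfDev, stdCDF_neg]; ring

lemma stdPDF_eq_logitDeriv_mul (x : ℝ) : stdPDF x = logitDeriv x * (1 / 4 - cdfDev x ^ 2) := by
  rw [← stdCDF_mul_neg, logitDeriv,
    div_mul_cancel₀ _ (mul_pos (stdCDF_pos x) (stdCDF_pos (-x))).ne']

lemma hasDerivAt_cdfLogit (x : ℝ) : HasDerivAt cdfLogit (logitDeriv x) x := by
  have h1 := (hasDerivAt_stdCDF x).log (stdCDF_pos x).ne'
  have h2 := (hasDerivAt_stdCDF_neg x).log (stdCDF_pos (-x)).ne'
  refine (h1.sub h2).congr_deriv ?_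
  have ha := stdCDF_pos x
  have hb := stdCDF_pos (-x)
  rw [logitDeriv]
  field_simp
  linear_combination stdPDF x * stdCDF_add_neg x

/-- Together with `hasDerivAt_cdfLogit` this says that the derivative of `symExponent` with respect
to the log-odds is `cdfDev`, the centred mean of the Bernoulli law. -/
lemma hasDerivAt_symExponent (x : ℝ) :
    HasDerivAt symExponent (logitDeriv x * cdfDev x) x := by
  have h1 := (hasDerivAt_stdCDF x).log (stdCDF_pos x).ne'
  have h2 := (hasDerivAt_stdCDF_neg x).log (stdCDF_pos (-x)).ne'
  refine (((h1.add h2).const_mul (-(1 / 2))).sub_const (Real.log 2)).congr_deriv ?_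
  have ha := stdCDF_pos x
  have hb := stdCDF_pos (-x)
  rw [logitDeriv, cdfDev]
  field_simp
  linear_combination -stdPDF x * stdCDF_add_neg x

lemma hasDerivAt_logitDeriv (x : ℝ) :
    HasDerivAt logitDeriv (logitDeriv x * (-x + 2 * cdfDev x * logitDeriv x)) x := by
  have h := (hasDerivAt_stdPDF x).div ((hasDerivAt_stdCDF x).mul (hasDerivAt_stdCDF_neg x))
    (mul_pos (stdCDF_pos x) (stdCDF_pos (-x))).ne'
  refine h.congr_deriv ?_
  have ha := (stdCDF_pos x).ne'
  have hb := (stdCDF_pos (-x)).ne'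
  have hp : cdfDev x = (stdCDF x - stdCDF (-x)) / 2 := by rw [cdfDev, stdCDF_neg]; ring
  rw [logitDeriv, hp]
  simp only [Pi.mul_apply]
  field_simp
  ring

lemma cdfLogit_strictMono : StrictMono cdfLogit :=
  strictMono_of_deriv_pos fun x => by rw [(hasDerivAt_cdfLogit x).deriv]; exact logitDeriv_pos x

lemma cdfLogit_pos {x : ℝ} (hx : 0 < x) : 0 < cdfLogit x := by
  simpa [cdfLogit_zero] using cdfLogit_strictMono hx

/-! ### Concavity of the derivative of `symExponent` in the log-odds. -/

lemma stdPDF_zero_sq : stdPDF 0 ^ 2 = 1 / (2 * Real.pi) := by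
  rw [stdPDF_eq]
  simp [mul_pow, Real.sq_sqrt Real.pi_pos.le]

lemma stdPDF_eq_zero_mul (x : ℝ) : stdPDF x = stdPDF 0 * Real.exp (-x ^ 2 / 2) := by
  simp [stdPDF_eq]

/-- (1 - w + w²/2)(1 + w + w²/2) = 1 + w⁴/4 ≥ 1. -/
lemma exp_neg_le_quadratic {w : ℝ} (hw : 0 ≤ w) : Real.exp (-w) ≤ 1 - w + w ^ 2 / 2 := by
  have h := Real.quadratic_le_exp_of_nonneg hw
  have h1 : 0 < 1 - w + w ^ 2 / 2 := by nlinarith [sq_nonneg (w - 1)]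
  rw [Real.exp_neg, inv_le_iff_one_le_mul₀ (Real.exp_pos w)]
  nlinarith [sq_nonneg (w ^ 2)]

lemma cdfDev_le_taylor {x : ℝ} (hx : 0 ≤ x) :
    cdfDev x ≤ stdPDF 0 * (x * (1 - x ^ 2 / 6 + x ^ 4 / 40)) := by
  set F : ℝ → ℝ := fun x => stdPDF 0 * (x - x ^ 3 / 6 + x ^ 5 / 40) - cdfDev x with hF
  have hd : ∀ x, HasDerivAt F (stdPDF 0 * (1 - x ^ 2 / 2 + x ^ 4 / 8) - stdPDF x) x := by
    intro x
    have h1 : HasDerivAt (fun x : ℝ => x - x ^ 3 / 6 + x ^ 5 / 40)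
        (1 - x ^ 2 / 2 + x ^ 4 / 8) x := by
      refine (((hasDerivAt_id x).sub ((hasDerivAt_pow 3 x).div_const 6)).add
        ((hasDerivAt_pow 5 x).div_const 40)).congr_deriv ?_
      norm_num
      ring
    exact (h1.const_mul _).sub (hasDerivAt_cdfDev x)
  have hmono : Monotone F := by
    refine monotone_of_deriv_nonneg (fun x => (hd x).differentiableAt) fun x => ?_
    rw [(hd x).deriv, stdPDF_eq_zero_mul x, ← mul_sub]
    refine mul_nonneg (stdPDF_pos 0).le ?_
    have := exp_neg_le_quadratic (w := x ^ 2 / 2) (by positivity)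
    rw [show -x ^ 2 / 2 = -(x ^ 2 / 2) by ring]
    linarith
  have := hmono hx
  simp only [hF, cdfDev_zero] at this
  linarith

/-- The small-argument half of `cdfDev_mul_logitDeriv_sq_le`. -/
lemma cdfDev_mul_logitDeriv_sq_le_of_le {x : ℝ} (hx : 0 < x) (hx2 : x ^ 2 ≤ 4 / 3) :
    cdfDev x * (logitDeriv x ^ 2 - 1) ≤ x * logitDeriv x / 2 := by
  have hφ := stdPDF_pos 0
  have hP := cdfDev_pos hx
  have hPt := cdfDev_le_taylor hx.le
  have hκ : stdPDF 0 ^ 2 ≤ 0.159155 := by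
    rw [stdPDF_zero_sq, div_le_iff₀ (by positivity)]
    nlinarith [Real.pi_gt_d6]
  set v := x ^ 2 with hv
  have hv0 : 0 ≤ v := sq_nonneg x
  have hx4 : x ^ 4 = v ^ 2 := by rw [hv]; ring
  rw [hx4] at hPt
  set g := 1 - v / 6 + v ^ 2 / 40 with hg
  have hg0 : 0 < g := by rw [hg]; nlinarith [sq_nonneg v]
  -- In terms of ζ the claim becomes `key2`, and ζ = (1 - 4 P²) e^{v/2} with P = `cdfDev x` can be
  -- bounded below by a polynomial.
  set ζ := 4 * stdPDF 0 / logitDeriv x with hζ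
  have hl := logitDeriv_pos x
  have hζ' : ζ = (1 - 4 * cdfDev x ^ 2) * Real.exp (v / 2) := by
    have h1 := stdPDF_eq_logitDeriv_mul x
    rw [stdPDF_eq_zero_mul x, show -x ^ 2 / 2 = -(v / 2) by rw [hv]; ring, Real.exp_neg] at h1
    have he := Real.exp_pos (v / 2)
    rw [hζ, div_eq_iff hl.ne']
    field_simp at h1
    linear_combination h1
  -- 0.63665 is slightly more than 4 φ(0)² = 2/π.
  have hE : 1 - 0.63665 * v * g ^ 2 ≤ 1 - 4 * cdfDev x ^ 2 := by
    have h1 : cdfDev x ^ 2 ≤ (stdPDF 0 * (x * g)) ^ 2 := pow_le_pow_left₀ hP.le hPt 2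
    have h2 : (stdPDF 0 * (x * g)) ^ 2 = stdPDF 0 ^ 2 * (v * g ^ 2) := by rw [hv]; ring
    have h3 : 0 ≤ v * g ^ 2 := by positivity
    nlinarith
  have hF : 1 + v / 2 + v ^ 2 / 8 + v ^ 3 / 48 ≤ Real.exp (v / 2) := by
    have := Real.sum_le_exp_of_nonneg (x := v / 2) (by positivity) 4
    simp only [Finset.sum_range_succ, Finset.sum_range_zero, Nat.factorial] at this
    norm_num at this
    linarith
  have hE0 : 0 ≤ 1 - 0.63665 * v * g ^ 2 := by
    have : g ≤ 1 := by rw [hg]; nlinarith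
    nlinarith [mul_nonneg hv0 hg0.le]
  -- To first order ζ is 1 - (2/π - 1/2) v, and 0.137 slightly exceeds 2/π - 1/2.
  have hz : 1 - 0.137 * v ≤ ζ := by
    rw [hζ']
    refine le_trans ?_ (mul_le_mul hE hF (by positivity) (hE0.trans hE))
    have hw : ∀ n : ℕ, v ^ n ≤ (4 / 3) ^ n := fun n => pow_le_pow_left₀ hv0 hx2 n
    have hw0 : ∀ n : ℕ, 0 ≤ v ^ n := fun n => pow_nonneg hv0 n
    have hb : 0 ≤ 2267 / 120000 - 15529 / 7200000 * v - 89131 / 14400000 * v ^ 2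
        + 140063 / 288000000 * v ^ 3 - 980441 / 1728000000 * v ^ 4
        + 140063 / 2304000000 * v ^ 5 - 12733 / 1536000000 * v ^ 6 := by
      have h2 := hw 2
      have h4 := hw 4
      have h6 := hw 6
      norm_num at h2 h4 h6
      linarith [hw0 3, hw0 5]
    have hv1 := mul_nonneg (hw0 2) hb
    have : (1 - 0.63665 * v * g ^ 2) * (1 + v / 2 + v ^ 2 / 8 + v ^ 3 / 48) - (1 - 0.137 * v)
        = 7 / 20000 * v + v ^ 2 * (2267 / 120000 - 15529 / 7200000 * v - 89131 / 14400000 * v ^ 2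
        + 140063 / 288000000 * v ^ 3 - 980441 / 1728000000 * v ^ 4
        + 140063 / 2304000000 * v ^ 5 - 12733 / 1536000000 * v ^ 6) := by
      rw [hg]
      ring
    linarith
  have hz0 : 0 < 1 - 0.137 * v := by nlinarith
  -- 2.5465 is slightly more than 16 φ(0)² = 8/π.
  have key : g * (2.5465 - (1 - 0.137 * v) ^ 2) ≤ 2 * (1 - 0.137 * v) := by
    rw [hg]
    nlinarith [mul_nonneg hv0 hv0, mul_nonneg (mul_nonneg hv0 hv0) hv0]
  have key2 : cdfDev x * (16 * stdPDF 0 ^ 2 - ζ ^ 2) ≤ 2 * stdPDF 0 * x * ζ := by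
    rcases le_or_gt (16 * stdPDF 0 ^ 2 - ζ ^ 2) 0 with h | h
    · have : 0 < ζ := hz0.trans_le hz
      exact (mul_nonpos_of_nonneg_of_nonpos hP.le h).trans (by positivity)
    · have h1 := mul_le_mul_of_nonneg_right hPt h.le
      have h2 : 16 * stdPDF 0 ^ 2 - ζ ^ 2 ≤ 2.5465 - (1 - 0.137 * v) ^ 2 := by nlinarith
      have h3 : g * (16 * stdPDF 0 ^ 2 - ζ ^ 2) ≤ 2 * ζ :=
        (mul_le_mul_of_nonneg_left h2 hg0.le).trans (key.trans (by linarith))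
      have h4 := mul_le_mul_of_nonneg_left h3 (mul_pos hφ hx).le
      linarith
  have hζl : ζ * logitDeriv x = 4 * stdPDF 0 := by rw [hζ, div_mul_cancel₀ _ hl.ne']
  have h5 := mul_le_mul_of_nonneg_right key2 (sq_nonneg (logitDeriv x))
  have h6 : cdfDev x * (16 * stdPDF 0 ^ 2 - ζ ^ 2) * logitDeriv x ^ 2
      = 16 * stdPDF 0 ^ 2 * (cdfDev x * (logitDeriv x ^ 2 - 1)) := by
    linear_combination (-cdfDev x * (ζ * logitDeriv x + 4 * stdPDF 0)) * hζl
  have h7 : 2 * stdPDF 0 * x * ζ * logitDeriv x ^ 2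
      = 16 * stdPDF 0 ^ 2 * (x * logitDeriv x / 2) := by
    linear_combination (2 * stdPDF 0 * x * logitDeriv x) * hζl
  rw [h6, h7] at h5
  exact le_of_mul_le_mul_left h5 (by positivity)

/-- The large-argument half of `cdfDev_mul_logitDeriv_sq_le`. -/
lemma cdfDev_mul_logitDeriv_sq_le_of_ge {x : ℝ} (hx : 0 < x) (hx2 : 4 / 3 ≤ x ^ 2) :
    cdfDev x * (logitDeriv x ^ 2 - 1) ≤ x * logitDeriv x / 2 := by
  set q := √(x ^ 2 + 4) with hq
  have hq2 : q ^ 2 = x ^ 2 + 4 := Real.sq_sqrt (by positivity)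
  have hq0 : 0 < q := by positivity
  set μ := (x + q) / 2 with hμ
  have hμ0 : 0 < μ := by positivity
  have hμx : μ ^ 2 - 1 = x * μ := by rw [hμ]; nlinarith
  -- Equality holds at x² = 4/3; this fixes the point where the two halves of the proof meet.
  have hμ3 : 3 ≤ μ ^ 2 := by nlinarith
  set t := stdCDF (-x) with ht
  have ht0 : 0 < t := stdCDF_pos (-x)
  have hP : cdfDev x = 1 / 2 - t := by rw [ht, stdCDF_neg, cdfDev]; ring
  have hPpos := cdfDev_pos hx
  have hΦ : stdCDF x = 1 - t := by rw [ht, stdCDF_neg]; ring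
  have hl := logitDeriv_pos x
  have hle : logitDeriv x * (1 - t) ≤ μ := by
    have h1 := birnbaum_le x
    rw [← hq, ← ht] at h1
    have h2 : (q - x) / 2 * μ = 1 := by rw [hμ]; nlinarith
    have h3 : stdPDF x ≤ t * μ := by
      calc stdPDF x = stdPDF x * ((q - x) / 2) * μ := by rw [mul_assoc, h2, mul_one]
        _ ≤ t * μ := mul_le_mul_of_nonneg_right h1 hμ0.le
    have h4 : stdPDF x = logitDeriv x * (1 - t) * t := by
      rw [logitDeriv, hΦ, ← ht]
      have : 1 - t ≠ 0 := by rw [← hΦ]; exact (stdCDF_pos x).ne'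
      field_simp
    rw [h4, mul_comm t] at h3
    exact le_of_mul_le_mul_right h3 ht0
  set l := logitDeriv x with hlx
  rw [hP] at hPpos ⊢
  set s := 1 - t with hs
  have hs0 : 0 < s := by rw [hs]; linarith
  -- The right side minus the left is t (μ² - (1 - t)(3 - 2t)), and (1 - t)(3 - 2t) ≤ 3 ≤ μ².
  have hmain : (1 - 2 * t) * (μ ^ 2 - s ^ 2) ≤ x * s * μ := by
    have : x * s * μ = s * (μ ^ 2 - 1) := by rw [hμx]; ring
    rw [this, hs]
    nlinarith [mul_pos ht0 hs0, mul_nonneg ht0.le (sub_nonneg.2 hμ3), mul_pos ht0 ht0,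
      mul_pos (mul_pos ht0 ht0) hs0]
  -- The quotient (z² - s²)/z increases with z, so the case z = μ implies the case z = l s ≤ μ.
  have hgoal : (1 - 2 * t) * ((l * s) ^ 2 - s ^ 2) ≤ x * s * (l * s) := by
    have hls : 0 < l * s := mul_pos hl hs0
    have h1 : 0 ≤ 1 - 2 * t := by linarith
    have h2 : μ * ((1 - 2 * t) * ((l * s) ^ 2 - s ^ 2))
        ≤ l * s * ((1 - 2 * t) * (μ ^ 2 - s ^ 2)) := by
      have : l * s * ((1 - 2 * t) * (μ ^ 2 - s ^ 2)) - μ * ((1 - 2 * t) * ((l * s) ^ 2 - s ^ 2))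
          = (1 - 2 * t) * (μ - l * s) * (μ * (l * s) + s ^ 2) := by ring
      have h3 : 0 ≤ (1 - 2 * t) * (μ - l * s) * (μ * (l * s) + s ^ 2) :=
        mul_nonneg (mul_nonneg h1 (by linarith)) (by positivity)
      linarith
    have h4 := mul_le_mul_of_nonneg_left hmain hls.le
    refine le_of_mul_le_mul_left (h2.trans (h4.trans_eq ?_)) hμ0
    ring
  have h5 : (1 / 2 - t) * (l ^ 2 - 1) * (2 * s ^ 2) ≤ x * l / 2 * (2 * s ^ 2) := by
    linarith
  exact le_of_mul_le_mul_right h5 (by positivity)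

/-- The difference of the two sides is the derivative of `R` in
`antitoneOn_symExponentDeriv_div_cdfLogit`. -/
lemma cdfDev_mul_logitDeriv_sq_le {x : ℝ} (hx : 0 < x) :
    cdfDev x * (logitDeriv x ^ 2 - 1) ≤ x * logitDeriv x / 2 :=
  (le_total (x ^ 2) (4 / 3)).elim (cdfDev_mul_logitDeriv_sq_le_of_le hx)
    (cdfDev_mul_logitDeriv_sq_le_of_ge hx)

/-- The ratio of `symExponent'` and `cdfLogit` decreases. -/
lemma antitoneOn_symExponentDeriv_div_cdfLogit :
    AntitoneOn (fun x => logitDeriv x * cdfDev x / cdfLogit x) (Set.Ioi 0) := by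
  -- `R` is the derivative of `logitDeriv * cdfDev` with respect to `cdfLogit`. As `R` decreases,
  -- this product is a concave function of the log-odds for positive x; it vanishes at 0, so its
  -- ratio to the log-odds decreases.
  set R : ℝ → ℝ := fun x => stdPDF x - x * cdfDev x + 2 * (cdfDev x ^ 2 * logitDeriv x) with hR
  have hdR : ∀ x, HasDerivAt R (cdfDev x * (logitDeriv x ^ 2 - 1) - x * logitDeriv x / 2) x := by
    intro x
    refine (((hasDerivAt_stdPDF x).sub ((hasDerivAt_id x).mul (hasDerivAt_cdfDev x))).add
      ((((hasDerivAt_cdfDev x).pow 2).mul (hasDerivAt_logitDeriv x)).const_mul 2)).congr_deriv ?_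
    simp only [Pi.pow_apply, id]
    rw [stdPDF_eq_logitDeriv_mul x]
    push_cast
    ring
  have hdN : ∀ x, HasDerivAt (fun x => logitDeriv x * cdfDev x) (R x * logitDeriv x) x := by
    intro x
    refine ((hasDerivAt_logitDeriv x).mul (hasDerivAt_cdfDev x)).congr_deriv ?_
    simp only [hR]
    ring
  have hG : ∀ x, 0 ≤ x → 0 ≤ logitDeriv x * cdfDev x - R x * cdfLogit x := by
    have hd : ∀ x, HasDerivAt (fun x => logitDeriv x * cdfDev x - R x * cdfLogit x)
        (-((cdfDev x * (logitDeriv x ^ 2 - 1) - x * logitDeriv x / 2) * cdfLogit x)) x := by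
      intro x
      refine ((hdN x).sub ((hdR x).mul (hasDerivAt_cdfLogit x))).congr_deriv ?_
      ring
    have hm : MonotoneOn (fun x => logitDeriv x * cdfDev x - R x * cdfLogit x) (Set.Ici 0) := by
      refine monotoneOn_of_deriv_nonneg (convex_Ici 0)
        (fun x _ => (hd x).continuousAt.continuousWithinAt)
        (fun x _ => (hd x).differentiableAt.differentiableWithinAt) fun x hx => ?_
      rw [interior_Ici] at hx
      rw [(hd x).deriv, neg_nonneg]
      exact mul_nonpos_of_nonpos_of_nonneg (by linarith [cdfDev_mul_logitDeriv_sq_le hx])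
        (cdfLogit_pos hx).le
    intro x hx
    simpa [cdfDev_zero, cdfLogit_zero] using hm Set.self_mem_Ici hx hx
  have hd : ∀ x, 0 < x → HasDerivAt (fun x => logitDeriv x * cdfDev x / cdfLogit x)
      (-(logitDeriv x * (logitDeriv x * cdfDev x - R x * cdfLogit x) / cdfLogit x ^ 2)) x := by
    intro x hx
    refine ((hdN x).div (hasDerivAt_cdfLogit x) (cdfLogit_pos hx).ne').congr_deriv ?_
    ring
  refine antitoneOn_of_deriv_nonpos (convex_Ioi 0)
    (fun x hx => (hd x hx).continuousAt.continuousWithinAt)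
    (fun x hx => ?_) fun x hx => ?_
  · rw [interior_Ioi] at hx
    exact (hd x hx).differentiableAt.differentiableWithinAt
  · rw [interior_Ioi] at hx
    have h1 := hG x (le_of_lt hx)
    have h2 := logitDeriv_pos x
    rw [(hd x hx).deriv, neg_nonpos]
    positivity

/-! ### An inequality for hyperbolic sines -/

lemma convexOn_sinh : ConvexOn ℝ (Set.Ici 0) Real.sinh := by
  refine MonotoneOn.convexOn_of_deriv (convex_Ici 0) Real.continuous_sinh.continuousOn
    Real.differentiable_sinh.differentiableOn ?_
  rw [interior_Ici, Real.deriv_sinh]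
  exact fun x hx y hy hxy => Real.cosh_le_cosh.2 (by rwa [abs_of_pos hx, abs_of_pos hy])

lemma sinh_div_self_monotoneOn : MonotoneOn (fun z => Real.sinh z / z) (Set.Ioi 0) := by
  intro x hx y hy hxy
  have := convexOn_sinh.secant_mono (a := 0) Set.self_mem_Ici (Set.Ioi_subset_Ici_self hx)
    (Set.Ioi_subset_Ici_self hy) (ne_of_gt hx) (ne_of_gt hy) hxy
  simpa using this

lemma convexOn_cosh_sqrt : ConvexOn ℝ (Set.Ici 0) fun w => Real.cosh √w := by
  have hd : ∀ w : ℝ, 0 < w → HasDerivAt (fun w => Real.cosh √w) (1 / 2 * (Real.sinh √w / √w)) w := by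
    intro w hw
    refine ((Real.hasDerivAt_cosh √w).comp w (Real.hasDerivAt_sqrt hw.ne')).congr_deriv ?_
    ring
  refine MonotoneOn.convexOn_of_deriv (convex_Ici 0)
    (Real.continuous_cosh.comp Real.continuous_sqrt).continuousOn ?_ ?_
  · rw [interior_Ici]
    exact fun w hw => (hd w hw).differentiableAt.differentiableWithinAt
  · rw [interior_Ici]
    intro v hv w hw hvw
    rw [(hd v hv).deriv, (hd w hw).deriv]
    have := sinh_div_self_monotoneOn (Real.sqrt_pos.2 hv) (Real.sqrt_pos.2 hw)
      (Real.sqrt_le_sqrt hvw)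
    simp only at this
    linarith

/-- Turns the product into twice the slope of a secant of the convex function cosh √w, between (p -
q)² and (p + q)². -/
lemma sinh_div_mul_sinh_div {p q : ℝ} :
    Real.sinh p / p * (Real.sinh q / q)
      = 2 * ((Real.cosh √((p - q) ^ 2) - Real.cosh √((p + q) ^ 2))
        / ((p - q) ^ 2 - (p + q) ^ 2)) := by
  rw [Real.sqrt_sq_eq_abs, Real.sqrt_sq_eq_abs, Real.cosh_abs, Real.cosh_abs, Real.cosh_add,
    Real.cosh_sub]
  rw [show (p - q) ^ 2 - (p + q) ^ 2 = -4 * (p * q) by ring,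
    show Real.cosh p * Real.cosh q - Real.sinh p * Real.sinh q
      - (Real.cosh p * Real.cosh q + Real.sinh p * Real.sinh q)
      = -2 * (Real.sinh p * Real.sinh q) by ring, div_mul_div_comm, mul_div_mul_comm]
  ring

/-- Both sides are secant slopes of cosh √w with the common endpoint (b - m + a)². The other
endpoints, (b - m - a)² and (m - a + b)², differ by 4 m (b - a) ≥ 0, so convexity applies. -/
lemma sinh_div_mul_sinh_div_le {a b m : ℝ} (ham : a < m) (hmb : m < b) (ha : a ≠ 0)
    (hm : 0 ≤ m) :
    Real.sinh (b - m) / (b - m) * (Real.sinh a / a)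
      ≤ Real.sinh (m - a) / (m - a) * (Real.sinh b / b) := by
  have hb : 0 < b := hm.trans_lt hmb
  have h := convexOn_cosh_sqrt.secant_mono (a := (b - m + a) ^ 2) (x := (b - m - a) ^ 2)
    (y := (m - a + b) ^ 2) (Set.mem_Ici.2 (sq_nonneg _)) (Set.mem_Ici.2 (sq_nonneg _))
    (Set.mem_Ici.2 (sq_nonneg _)) ?_ ?_ ?_
  · rw [sinh_div_mul_sinh_div, sinh_div_mul_sinh_div]
    rw [← neg_sub (Real.cosh √((m - a + b) ^ 2)), ← neg_sub ((m - a + b) ^ 2), neg_div_neg_eq,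
      show (m - a - b) ^ 2 = (b - m + a) ^ 2 by ring]
    linarith
  · intro h
    have : (b - m) * a = 0 := by linarith
    rcases mul_eq_zero.1 this with h | h
    · linarith
    · exact ha h
  · intro h
    have : b * (m - a) = 0 := by linarith
    rcases mul_eq_zero.1 this with h | h <;> linarith
  · have : 0 ≤ m * (b - a) := mul_nonneg hm (by linarith)
    linarith

/-! ### Chernoff information of shifted Gaussian thresholds -/

lemma half_add_cdfDev (x : ℝ) : 1 / 2 + cdfDev x = stdCDF x := by rw [cdfDev]; ring

lemma half_sub_cdfDev (x : ℝ) : 1 / 2 - cdfDev x = stdCDF (-x) := by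
  rw [cdfDev, stdCDF_neg]; ring

lemma tanh_half_cdfLogit (x : ℝ) :
    Real.sinh (cdfLogit x / 2) = 2 * cdfDev x * Real.cosh (cdfLogit x / 2) := by
  have h1 : Real.exp (cdfLogit x / 2) * Real.exp (cdfLogit x / 2) * stdCDF (-x) = stdCDF x := by
    rw [← Real.exp_add, add_halves, cdfLogit, Real.exp_sub, Real.exp_log (stdCDF_pos x),
      Real.exp_log (stdCDF_pos _), div_mul_cancel₀ _ (stdCDF_pos _).ne']
  rw [Real.sinh_eq, Real.cosh_eq, Real.exp_neg]
  have he := Real.exp_pos (cdfLogit x / 2)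
  set e := Real.exp (cdfLogit x / 2)
  rw [← half_sub_cdfDev, ← half_add_cdfDev x] at h1
  field_simp
  linear_combination 2 * h1

lemma cdfDev_sub_cdfDev (x y : ℝ) :
    (cdfDev y - cdfDev x) * (2 * Real.cosh (cdfLogit x / 2) * Real.cosh (cdfLogit y / 2))
      = Real.sinh (cdfLogit y / 2 - cdfLogit x / 2) := by
  rw [Real.sinh_sub, tanh_half_cdfLogit, tanh_half_cdfLogit]
  ring

lemma symExponent_strictMonoOn : StrictMonoOn symExponent (Set.Ici 0) := by
  refine strictMonoOn_of_deriv_pos (convex_Ici 0)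
    (fun x _ => (hasDerivAt_symExponent x).continuousAt.continuousWithinAt) fun x hx => ?_
  rw [interior_Ici] at hx
  rw [(hasDerivAt_symExponent x).deriv]
  exact mul_pos (logitDeriv_pos x) (cdfDev_pos hx)

lemma symExponent_abs (x : ℝ) : symExponent |x| = symExponent x := by
  rcases abs_choice x with h | h <;> rw [h]
  exact symExponent_neg x

/-- Slope of the chord of `symExponent` as a function of `cdfLogit`. -/
def chordSlope (x y : ℝ) : ℝ :=
  (symExponent y - symExponent x) / (cdfLogit y - cdfLogit x)

/-- Cauchy's mean value theorem, as `cdfDev` is the ratio of the two derivatives. The point c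
parametrizes the Bernoulli law equidistant from the two given ones. -/
lemma exists_chordSlope_eq {x y : ℝ} (hxy : x < y) :
    ∃ c, x < c ∧ c < y ∧ chordSlope x y = cdfDev c := by
  obtain ⟨c, hc, h⟩ := exists_ratio_hasDerivAt_eq_ratio_slope symExponent
    (fun x => logitDeriv x * cdfDev x) hxy
    (fun x _ => (hasDerivAt_symExponent x).continuousAt.continuousWithinAt)
    (fun x _ => hasDerivAt_symExponent x) cdfLogit logitDeriv
    (fun x _ => (hasDerivAt_cdfLogit x).continuousAt.continuousWithinAt)
    (fun x _ => hasDerivAt_cdfLogit x)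
  refine ⟨c, hc.1, hc.2, ?_⟩
  rw [chordSlope, div_eq_iff (sub_pos.2 (cdfLogit_strictMono hxy)).ne']
  have := logitDeriv_pos c
  apply mul_left_cancel₀ this.ne'
  linear_combination -h

/-- This gives the sign of the numerator in `hasDerivAt_shiftExponent`. Writing differences of
`cdfDev` as hyperbolic sines of half log-odds splits the claim into the monotone ratio at |x| < y
and `sinh_div_mul_sinh_div_le`. -/
lemma logitDeriv_mul_chord_le {x y c : ℝ} (hx : x ≠ 0) (hxy : |x| < y) (hxc : x < c)
    (hcy : c < y) (hc : 0 ≤ c) :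
    (cdfDev y - cdfDev c) * logitDeriv y * (cdfLogit c - cdfLogit x)
      ≤ (cdfDev c - cdfDev x) * logitDeriv x * (cdfLogit y - cdfLogit c) := by
  have hy : 0 < y := (abs_nonneg x).trans_lt hxy
  have hm : 0 ≤ cdfLogit c := by
    simpa [cdfLogit_zero] using cdfLogit_strictMono.monotone hc
  have hxc' := cdfLogit_strictMono hxc
  have hcy' := cdfLogit_strictMono hcy
  have hθx : cdfLogit x ≠ 0 := by
    rw [← cdfLogit_zero]; exact cdfLogit_strictMono.injective.ne hx
  have hθy := cdfLogit_pos hy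
  have hS := sinh_div_mul_sinh_div_le (a := cdfLogit x / 2) (b := cdfLogit y / 2)
    (m := cdfLogit c / 2) (by linarith) (by linarith) (div_ne_zero hθx two_ne_zero) (by linarith)
  have hr : logitDeriv y * cdfDev y / cdfLogit y ≤ logitDeriv x * cdfDev x / cdfLogit x := by
    have h := antitoneOn_symExponentDeriv_div_cdfLogit (abs_pos.2 hx) hy hxy.le
    rcases abs_choice x with h' | h' <;> simp only [h'] at h
    · exact h
    · simpa [logitDeriv_neg, cdfDev_neg, cdfLogit_neg] using h
  set r := logitDeriv y * cdfDev y / cdfLogit y with hr1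
  set r' := logitDeriv x * cdfDev x / cdfLogit x with hr2
  have hr0 : 0 < r := div_pos (mul_pos (logitDeriv_pos y) (cdfDev_pos hy)) hθy
  have e1 : logitDeriv y * cdfDev y = r * cdfLogit y := by rw [hr1]; field_simp
  have e2 : logitDeriv x * cdfDev x = r' * cdfLogit x := by rw [hr2]; field_simp
  have f1 := cdfDev_sub_cdfDev c y
  have f2 := cdfDev_sub_cdfDev x c
  have g1 := tanh_half_cdfLogit y
  have g2 := tanh_half_cdfLogit x
  have hcc := Real.cosh_pos (cdfLogit c / 2)
  have hcy0 := Real.cosh_pos (cdfLogit y / 2)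
  have hcx0 := Real.cosh_pos (cdfLogit x / 2)
  have hsx : Real.sinh (cdfLogit x / 2) / (cdfLogit x / 2) > 0 := by
    rcases lt_or_gt_of_ne hθx with h | h
    · exact div_pos_of_neg_of_neg (Real.sinh_neg_iff.2 (by linarith)) (by linarith)
    · exact div_pos (Real.sinh_pos_iff.2 (by linarith)) (by linarith)
  have hsy : Real.sinh (cdfLogit y / 2) / (cdfLogit y / 2) > 0 :=
    div_pos (Real.sinh_pos_iff.2 (by linarith)) (by linarith)
  set a := cdfLogit x
  set b := cdfLogit y
  set m := cdfLogit c
  set Sx := Real.sinh (a / 2) / (a / 2) with hSx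
  set Sy := Real.sinh (b / 2) / (b / 2) with hSy
  set T1 := Real.sinh (b / 2 - m / 2) / (b / 2 - m / 2) with hT1
  set T2 := Real.sinh (m / 2 - a / 2) / (m / 2 - a / 2) with hT2
  have hd1 : 0 < b / 2 - m / 2 := by linarith
  have hd2 : 0 < m / 2 - a / 2 := by linarith
  have hT1p : 0 < T1 := div_pos (Real.sinh_pos_iff.2 hd1) hd1
  have hT2p : 0 < T2 := div_pos (Real.sinh_pos_iff.2 hd2) hd2
  have i1 : Real.sinh (b / 2 - m / 2) = T1 * (b / 2 - m / 2) := by rw [hT1]; field_simp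
  have i2 : Real.sinh (m / 2 - a / 2) = T2 * (m / 2 - a / 2) := by rw [hT2]; field_simp
  have i3 : Real.sinh (b / 2) = Sy * (b / 2) := by rw [hSy]; field_simp
  have i4 : Real.sinh (a / 2) = Sx * (a / 2) := by rw [hSx]; field_simp
  rw [i1] at f1
  rw [i2] at f2
  rw [i3] at g1
  rw [i4] at g2
  -- both sides in terms of `r`, `r'` and the quotients `sinh z / z`
  have j1 : logitDeriv y * Sy = 4 * r * Real.cosh (b / 2) := by
    apply mul_right_cancel₀ hθy.ne'
    linear_combination 2 * logitDeriv y * g1 + 4 * Real.cosh (b / 2) * e1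
  have j2 : logitDeriv x * Sx = 4 * r' * Real.cosh (a / 2) := by
    apply mul_right_cancel₀ hθx
    linear_combination 2 * logitDeriv x * g2 + 4 * Real.cosh (a / 2) * e2
  have hfin : r * (T1 * Sx) ≤ r' * (T2 * Sy) :=
    mul_le_mul hr hS (by positivity) (hr0.le.trans hr)
  have hK : 0 < Sx * Sy * Real.cosh (m / 2) := by positivity
  refine le_of_mul_le_mul_right ?_ hK
  have k1 : (cdfDev y - cdfDev c) * logitDeriv y * (m - a) * (Sx * Sy * Real.cosh (m / 2))
      = r * (T1 * Sx) * ((b - m) * (m - a)) := by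
    linear_combination (cdfDev y - cdfDev c) * (m - a) * Sx * Real.cosh (m / 2) * j1
      + 2 * r * (m - a) * Sx * f1
  have k2 : (cdfDev c - cdfDev x) * logitDeriv x * (b - m) * (Sx * Sy * Real.cosh (m / 2))
      = r' * (T2 * Sy) * ((b - m) * (m - a)) := by
    linear_combination (cdfDev c - cdfDev x) * (b - m) * Sy * Real.cosh (m / 2) * j2
      + 2 * r' * (b - m) * Sy * f2
  rw [k1, k2]
  exact mul_le_mul_of_nonneg_right hfin (mul_nonneg (by linarith) (by linarith))

/-! ### The equidistant Bernoulli law and its relative entropy. -/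

/-- The negative entropy of the Bernoulli law with parameter `1 / 2 + k`. -/
def negEntropy (k : ℝ) : ℝ :=
  (1 / 2 + k) * Real.log (1 / 2 + k) + (1 / 2 - k) * Real.log (1 / 2 - k)

/-- Legendre duality: the derivative of negative entropy in the mean is the log-odds. -/
lemma hasDerivAt_negEntropy (c : ℝ) : HasDerivAt negEntropy (cdfLogit c) (cdfDev c) := by
  have h1 : HasDerivAt (fun k : ℝ => 1 / 2 + k) 1 (cdfDev c) := (hasDerivAt_id _).const_add _
  have h2 : HasDerivAt (fun k : ℝ => 1 / 2 - k) (-1) (cdfDev c) := (hasDerivAt_id _).const_sub _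
  have p1 : 1 / 2 + cdfDev c ≠ 0 := by rw [half_add_cdfDev]; exact (stdCDF_pos c).ne'
  have p2 : 1 / 2 - cdfDev c ≠ 0 := by rw [half_sub_cdfDev]; exact (stdCDF_pos _).ne'
  refine ((h1.mul (h1.log p1)).add (h2.mul (h2.log p2))).congr_deriv ?_
  rw [cdfLogit, ← half_sub_cdfDev, ← half_add_cdfDev c]
  linear_combination mul_inv_cancel₀ p1 - mul_inv_cancel₀ p2

/-- The Chernoff information between the Bernoulli laws with parameters `stdCDF (u - h)` and
`stdCDF (u + h)`. -/
def shiftExponent (h u : ℝ) : ℝ :=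
  negEntropy (chordSlope (u - h) (u + h)) + Real.log 2 + symExponent (u - h)
    - chordSlope (u - h) (u + h) * cdfLogit (u - h)

lemma hasDerivAt_shiftExponent {h u c : ℝ} (hh : 0 < h)
    (hc : chordSlope (u - h) (u + h) = cdfDev c) :
    HasDerivAt (shiftExponent h)
      (((cdfDev (u + h) - cdfDev c) * logitDeriv (u + h) * (cdfLogit c - cdfLogit (u - h))
        - (cdfDev c - cdfDev (u - h)) * logitDeriv (u - h) * (cdfLogit (u + h) - cdfLogit c))
        / (cdfLogit (u + h) - cdfLogit (u - h))) u := by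
  have hx : HasDerivAt (fun u => u - h) 1 u := (hasDerivAt_id u).sub_const h
  have hy : HasDerivAt (fun u => u + h) 1 u := (hasDerivAt_id u).add_const h
  have a1 := (hasDerivAt_cdfLogit (u - h)).comp u hx
  have b1 := (hasDerivAt_cdfLogit (u + h)).comp u hy
  have pa := (hasDerivAt_symExponent (u - h)).comp u hx
  have pb := (hasDerivAt_symExponent (u + h)).comp u hy
  have hne : 0 < cdfLogit (u + h) - cdfLogit (u - h) :=
    sub_pos.2 (cdfLogit_strictMono (by linarith))
  have hk := (pb.sub pa).div (b1.sub a1) hne.ne'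
  have hk' : HasDerivAt (fun u => chordSlope (u - h) (u + h)) _ u := hk
  have he : HasDerivAt (fun u => negEntropy (chordSlope (u - h) (u + h))) _ u :=
    HasDerivAt.comp (h₂ := negEntropy) (h := fun u => chordSlope (u - h) (u + h)) u
      (by rw [hc]; exact hasDerivAt_negEntropy c) hk'
  refine (((he.add_const (Real.log 2)).add pa).sub (hk'.mul a1)).congr_deriv ?_
  have hc2 : symExponent (u + h) - symExponent (u - h)
      = cdfDev c * (cdfLogit (u + h) - cdfLogit (u - h)) := by
    rw [← hc, chordSlope, div_mul_cancel₀ _ hne.ne']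
  simp only [Function.comp, Pi.sub_apply, hc, hc2]
  field_simp
  ring

lemma shiftExponent_zero (h : ℝ) : shiftExponent h 0 = symExponent h := by
  have : chordSlope (0 - h) (0 + h) = 0 := by
    rw [chordSlope, zero_sub, zero_add, symExponent_neg, sub_self, zero_div]
  rw [shiftExponent, this, zero_sub, symExponent_neg, negEntropy]
  have : Real.log (1 / 2) = -Real.log 2 := by rw [one_div, Real.log_inv]
  rw [add_zero, sub_zero, this]
  ring

lemma shiftExponent_le {h u : ℝ} (hh : 0 < h) (hu : 0 ≤ u) :
    shiftExponent h u ≤ symExponent h := by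
  have hD : ∀ u, ∃ d, HasDerivAt (shiftExponent h) d u ∧ (0 < u → u ≠ h → d ≤ 0) := by
    intro u
    obtain ⟨c, h1, h2, hc⟩ := exists_chordSlope_eq (show u - h < u + h by linarith)
    refine ⟨_, hasDerivAt_shiftExponent hh hc, fun hu hne => ?_⟩
    have habs : |u - h| < u + h := abs_lt.2 ⟨by linarith, by linarith⟩
    have hθ := cdfLogit_strictMono (show u - h < u + h by linarith)
    have hc0 : 0 < c := by
      have h3 : 0 < chordSlope (u - h) (u + h) := by
        refine div_pos ?_ (sub_pos.2 hθ)
        rw [sub_pos, ← symExponent_abs (u - h)]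
        exact symExponent_strictMonoOn (Set.mem_Ici.2 (abs_nonneg _))
          (Set.mem_Ici.2 ((abs_nonneg _).trans habs.le)) habs
      rw [hc, ← cdfDev_zero] at h3
      exact cdfDev_strictMono.lt_iff_lt.1 h3
    have := logitDeriv_mul_chord_le (sub_ne_zero.2 hne) habs h1 h2 hc0.le
    exact div_nonpos_of_nonpos_of_nonneg (by linarith) (sub_pos.2 hθ).le
  have hcont : Continuous (shiftExponent h) := continuous_iff_continuousAt.2 fun u =>
    (hD u).choose_spec.1.continuousAt
  have hanti : ∀ s : Set ℝ, Convex ℝ s → (∀ u ∈ interior s, 0 < u ∧ u ≠ h) →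
      AntitoneOn (shiftExponent h) s := by
    intro s hs hi
    refine antitoneOn_of_deriv_nonpos hs hcont.continuousOn
      (fun u _ => (hD u).choose_spec.1.differentiableAt.differentiableWithinAt) fun u hu => ?_
    rw [(hD u).choose_spec.1.deriv]
    exact (hD u).choose_spec.2 (hi u hu).1 (hi u hu).2
  have h1 := hanti (Set.Icc 0 h) (convex_Icc 0 h) fun u hu => by
    rw [interior_Icc] at hu; exact ⟨hu.1, hu.2.ne⟩
  have h2 := hanti (Set.Ici h) (convex_Ici h) fun u hu => by
    rw [interior_Ici] at hu; exact ⟨hh.trans hu, ne_of_gt hu⟩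
  rw [← shiftExponent_zero]
  -- At u = h the left parameter u - h vanishes and the sinh inequality is unavailable, so
  -- monotonicity is proved on each side of h and joined by continuity.
  rcases le_total u h with huh | huh
  · exact h1 ⟨le_rfl, hh.le⟩ ⟨hu, huh⟩ hu
  · exact (h2 Set.self_mem_Ici huh huh).trans (h1 ⟨le_rfl, hh.le⟩ ⟨hh.le, le_rfl⟩ hh.le)

/-- The relative entropy of Bernoulli laws with parameters `r` and `p`. -/
def klBer (r p : ℝ) : ℝ :=
  r * (Real.log r - Real.log p) + (1 - r) * (Real.log (1 - r) - Real.log (1 - p))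

lemma klBer_compl (r p : ℝ) : klBer (1 - r) (1 - p) = klBer r p := by
  rw [klBer, klBer, sub_sub_cancel, sub_sub_cancel, add_comm]

lemma exists_klBer_le_of_nonneg {h u : ℝ} (hh : 0 < h) (hu : 0 ≤ u) :
    ∃ r, stdCDF (u - h) ≤ r ∧ r ≤ stdCDF (u + h) ∧ klBer r (stdCDF (u - h)) ≤ symExponent h ∧
      klBer r (stdCDF (u + h)) ≤ symExponent h := by
  have hlt : u - h < u + h := by linarith
  obtain ⟨c, h1, h2, hc⟩ := exists_chordSlope_eq hlt
  -- Relative entropy in Bregman form. It takes equal values at u - h and u + h exactly because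
  -- `cdfDev c` is the slope of the chord.
  have key : ∀ x, klBer (stdCDF c) (stdCDF x)
      = negEntropy (cdfDev c) + Real.log 2 + symExponent x - cdfDev c * cdfLogit x := by
    intro x
    rw [klBer, negEntropy, symExponent, cdfLogit, half_add_cdfDev, half_sub_cdfDev,
      ← stdCDF_neg, ← stdCDF_neg, stdCDF_neg c, cdfDev]
    ring
  have hs := shiftExponent_le hh hu
  rw [shiftExponent, hc] at hs
  refine ⟨stdCDF c, (stdCDF_strictMono h1).le, (stdCDF_strictMono h2).le, ?_, ?_⟩
  · rwa [key]
  · rw [key]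
    rw [chordSlope, div_eq_iff (sub_pos.2 (cdfLogit_strictMono hlt)).ne'] at hc
    linarith

lemma exists_klBer_le {h : ℝ} (hh : 0 < h) (u : ℝ) :
    ∃ r, stdCDF (u - h) ≤ r ∧ r ≤ stdCDF (u + h) ∧ klBer r (stdCDF (u - h)) ≤ symExponent h ∧
      klBer r (stdCDF (u + h)) ≤ symExponent h := by
  rcases le_total 0 u with hu | hu
  · exact exists_klBer_le_of_nonneg hh hu
  · obtain ⟨r, h1, h2, h3, h4⟩ := exists_klBer_le_of_nonneg hh (neg_nonneg.2 hu)
    rw [show -u - h = -(u + h) by ring, stdCDF_neg] at h1 h3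
    rw [show -u + h = -(u - h) by ring, stdCDF_neg] at h2 h4
    refine ⟨1 - r, by linarith, by linarith, ?_, ?_⟩
    · rwa [← klBer_compl, sub_sub_cancel]
    · rwa [← klBer_compl, sub_sub_cancel]

/-! ### Relative entropy of Bernoulli laws -/

lemma klBer_self (r : ℝ) : klBer r r = 0 := by simp [klBer]

lemma log_sub_log_le {a b : ℝ} (ha : 0 < a) (hb : 0 < b) :
    Real.log b - Real.log a ≤ (b - a) / a := by
  rw [← Real.log_div hb.ne' ha.ne']
  refine (Real.log_le_sub_one_of_pos (div_pos hb ha)).trans_eq ?_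
  field_simp

lemma klBer_le_klBer_right {r q q' : ℝ} (hr : 0 ≤ r) (hrq : r ≤ q) (hq : 0 < q) (hqq : q ≤ q')
    (hq' : q' < 1) : klBer r q ≤ klBer r q' := by
  have h1 := log_sub_log_le hq (hq.trans_le hqq)
  have h2 := log_sub_log_le (a := 1 - q) (b := 1 - q') (by linarith) (by linarith)
  have h3 := mul_le_mul_of_nonneg_left h1 hr
  have h4 := mul_le_mul_of_nonneg_left h2 (show 0 ≤ 1 - r by linarith)
  have h5 : r * ((q' - q) / q) + (1 - r) * ((1 - q' - (1 - q)) / (1 - q))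
      = -((q' - q) * (q - r) / (q * (1 - q))) := by
    have : 1 - q ≠ 0 := by linarith
    field_simp
    ring
  have h6 : 0 ≤ (q' - q) * (q - r) / (q * (1 - q)) :=
    div_nonneg (mul_nonneg (by linarith) (by linarith)) (mul_nonneg hq.le (by linarith))
  rw [klBer, klBer]
  linarith

lemma klBer_nonneg {r p : ℝ} (hp : 0 < p) (hpr : p ≤ r) (hr : r < 1) : 0 ≤ klBer r p := by
  rw [← klBer_compl, ← klBer_self (1 - r)]
  exact klBer_le_klBer_right (by linarith) le_rfl (by linarith) (by linarith) (by linarith)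

/-- The Pythagorean identity for relative entropy, with a nonnegative cross term since p ≤ d ≤ r. -/
lemma klBer_le_klBer_left {p d r : ℝ} (hp : 0 < p) (hpd : p ≤ d) (hdr : d ≤ r) (hr : r < 1) :
    klBer d p ≤ klBer r p := by
  have h1 := klBer_nonneg (hp.trans_le hpd) hdr hr
  have h2 : klBer r p = klBer r d + klBer d p
      + (r - d) * ((Real.log d - Real.log p) + (Real.log (1 - p) - Real.log (1 - d))) := by
    rw [klBer, klBer, klBer]
    ring
  have h3 := Real.log_le_log hp hpd
  have h4 := Real.log_le_log (show 0 < 1 - d by linarith) (show 1 - d ≤ 1 - p by linarith)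
  have h5 : 0 ≤ (r - d) * ((Real.log d - Real.log p) + (Real.log (1 - p) - Real.log (1 - d))) :=
    mul_nonneg (by linarith) (by linarith)
  linarith

lemma symExponent_nonneg (h : ℝ) : 0 ≤ symExponent h := by
  have h1 : symExponent 0 = 0 := by
    have : Real.log (1 / 2) = -Real.log 2 := by rw [one_div, Real.log_inv]
    rw [symExponent, neg_zero, stdCDF_zero, this]
    ring
  rw [← h1, ← symExponent_abs h]
  exact symExponent_strictMonoOn.monotoneOn Set.self_mem_Ici (Set.mem_Ici.2 (abs_nonneg h))
    (abs_nonneg h)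

/-- The hypothesis q² ≤ M p keeps both log-ratios within log (M / r), and log z ≤ 2 √z then gives r
log² (M / r) ≤ 4 M. This makes the variance bound uniform over all local rules. -/
lemma mul_log_sub_log_sq_le {M p q r : ℝ} (hM : 1 ≤ M) (hp : 0 ≤ p) (hpr : p ≤ r) (hrq : r ≤ q)
    (hq1 : q ≤ 1) (h : q ^ 2 ≤ M * p) :
    r * (Real.log r - Real.log p) ^ 2 ≤ 4 * M ∧ r * (Real.log r - Real.log q) ^ 2 ≤ 4 * M := by
  rcases hp.eq_or_lt with rfl | hp
  · have hq0 : q = 0 := by nlinarith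
    have hr0 : r = 0 := by linarith
    rw [hr0]
    constructor <;> linarith
  have hr : 0 < r := hp.trans_le hpr
  have hq : 0 < q := hr.trans_le hrq
  have hM0 : 0 < M := by linarith
  have l1 := Real.log_le_log hp hpr
  have l2 := Real.log_le_log hr hrq
  have l3 : 2 * Real.log q ≤ Real.log M + Real.log p := by
    rw [← Real.log_mul hM0.ne' hp.ne']
    have := Real.log_le_log (by positivity) h
    rwa [Real.log_pow] at this
  have l4 : Real.log q ≤ 0 := Real.log_nonpos hq.le hq1
  have l5 : 0 ≤ Real.log M := Real.log_nonneg hM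
  have l6 : Real.log M - Real.log r ≤ 2 * √(M / r) := by
    rw [← Real.log_div hM0.ne' hr.ne']
    have := Real.log_le_sub_one_of_pos (Real.sqrt_pos.2 (div_pos hM0 hr))
    rw [Real.log_sqrt (div_pos hM0 hr).le] at this
    linarith
  have key : ∀ d : ℝ, |d| ≤ Real.log M - Real.log r → r * d ^ 2 ≤ 4 * M := by
    intro d hd
    have h1 : d ^ 2 ≤ (2 * √(M / r)) ^ 2 := by
      rw [← sq_abs]
      exact pow_le_pow_left₀ (abs_nonneg d) (hd.trans l6) 2
    rw [mul_pow, Real.sq_sqrt (div_pos hM0 hr).le] at h1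
    calc r * d ^ 2 ≤ r * (2 ^ 2 * (M / r)) := mul_le_mul_of_nonneg_left h1 hr.le
      _ = 4 * M := by field_simp; norm_num
  constructor <;> apply key <;> rw [abs_le] <;> constructor <;> linarith

/-! ### Binary quantizations of two Gaussian laws -/

lemma integrable_of_mem_Icc {Ω : Type*} {mΩ : MeasurableSpace Ω} {μ : Measure Ω}
    [IsFiniteMeasure μ] {g : Ω → ℝ} (hg : Measurable g) (h : ∀ y, g y ∈ Set.Icc 0 1) :
    Integrable g μ :=
  Integrable.of_mem_Icc 0 1 hg.aemeasurable (.of_forall h)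

lemma integrable_gaussianPDFReal_mul (m : ℝ) (v : ℝ≥0) {g : ℝ → ℝ} (hg : Measurable g)
    (h : ∀ y, g y ∈ Set.Icc 0 1) : Integrable (fun y => gaussianPDFReal m v y * g y) := by
  refine (integrable_gaussianPDFReal m v).mul_bdd (c := 1) hg.aestronglyMeasurable
    (.of_forall fun y => ?_)
  rw [Real.norm_eq_abs, abs_of_nonneg (h y).1]
  exact (h y).2

lemma gaussianPDFReal_sq (m m' : ℝ) (v : ℝ≥0) (hv : v ≠ 0) (y : ℝ) :
    gaussianPDFReal m' v y ^ 2 = gaussianPDFReal m v y *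
      (Real.exp ((m' - m) ^ 2 / v) * gaussianPDFReal (2 * m' - m) v y) := by
  simp only [gaussianPDFReal]
  have hv' : (v : ℝ) ≠ 0 := by exact_mod_cast hv
  have : ∀ a b c d e : ℝ, a * Real.exp b * (Real.exp c * (a * Real.exp d))
      = a ^ 2 * Real.exp (b + c + d) := by
    intro a b c d e
    rw [Real.exp_add, Real.exp_add]
    ring
  rw [this _ _ _ _ 0, mul_pow, ← Real.exp_nat_mul]
  congr 2
  push_cast
  field_simp
  ring

/-- Cauchy–Schwarz with weight f₁²/f₀, whose integral is the exponential factor by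
`gaussianPDFReal_sq`. -/
lemma sq_integral_gaussianReal_le (m m' : ℝ) {v : ℝ≥0} (hv : v ≠ 0) {g : ℝ → ℝ}
    (hg : Measurable g) (h : ∀ y, g y ∈ Set.Icc 0 1) :
    (∫ y, g y ∂gaussianReal m' v) ^ 2
      ≤ Real.exp ((m' - m) ^ 2 / v) * ∫ y, g y ∂gaussianReal m v := by
  rw [integral_gaussianReal_eq_integral_smul hv, integral_gaussianReal_eq_integral_smul hv]
  simp only [smul_eq_mul]
  set M := Real.exp ((m' - m) ^ 2 / v) with hM
  have i0 := integrable_gaussianPDFReal_mul m v hg h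
  have i1 := integrable_gaussianPDFReal_mul m' v hg h
  have i2 := integrable_gaussianPDFReal (2 * m' - m) v
  -- The integrand is g f₀ (c - f₁/f₀)² + (1 - g) f₁²/f₀; the discriminant of this quadratic in c
  -- yields the claim.
  have key : ∀ c : ℝ, 0 ≤ (∫ y, gaussianPDFReal m v y * g y) * (c * c)
      + (-2 * ∫ y, gaussianPDFReal m' v y * g y) * c + M := by
    intro c
    have e1 : (∫ y, gaussianPDFReal m v y * g y) * (c * c)
        + (-2 * ∫ y, gaussianPDFReal m' v y * g y) * c + M
        = ∫ y, ((c * c) * (gaussianPDFReal m v y * g y)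
          + (-2 * c) * (gaussianPDFReal m' v y * g y) + M * gaussianPDFReal (2 * m' - m) v y) := by
      have i01 : Integrable fun y => (c * c) * (gaussianPDFReal m v y * g y)
          + (-2 * c) * (gaussianPDFReal m' v y * g y) := (i0.const_mul _).add (i1.const_mul _)
      rw [integral_add i01 (i2.const_mul _),
        integral_add (i0.const_mul _) (i1.const_mul _), integral_const_mul, integral_const_mul,
        integral_const_mul, integral_gaussianPDFReal_eq_one _ hv]
      ring
    rw [e1]
    refine integral_nonneg fun y => ?_
    have p0 := gaussianPDFReal_pos m v y hv
    have p1 := gaussianPDFReal_pos m' v y hv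
    have p2 := gaussianPDFReal_pos (2 * m' - m) v y hv
    have hM0 : 0 < M := Real.exp_pos _
    have hs := gaussianPDFReal_sq m m' v hv y
    rw [← hM] at hs
    set f0 := gaussianPDFReal m v y
    set f1 := gaussianPDFReal m' v y
    set f2 := gaussianPDFReal (2 * m' - m) v y
    obtain ⟨g0, g1⟩ := h y
    have q : 0 ≤ c ^ 2 * f0 - 2 * c * f1 + M * f2 := by
      have : f0 * (c ^ 2 * f0 - 2 * c * f1 + M * f2) = (c * f0 - f1) ^ 2 := by
        linear_combination -hs
      refine nonneg_of_mul_nonneg_right (a := f0) ?_ p0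
      rw [this]
      positivity
    have q2 := mul_nonneg g0 q
    have q3 : 0 ≤ (1 - g y) * (M * f2) := mul_nonneg (by linarith) (by positivity)
    simp only [Pi.zero_apply]
    linarith
  have := discrim_le_zero key
  rw [discrim] at this
  linarith

lemma gaussianReal_real_Ioi (m : ℝ) {s : ℝ≥0} (hs : 0 < s) (t : ℝ) :
    (gaussianReal m (s ^ 2)).real (Set.Ioi t) = stdCDF ((m - t) / s) := by
  have h1 : ∀ x, (gaussianReal 0 1).real (Set.Ioi x) = stdCDF (-x) := by
    intro x
    rw [measureReal_def, gaussianReal_apply_eq_integral _ one_ne_zero, stdCDF, neg_neg]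
    exact ENNReal.toReal_ofReal (gaussianQ_mem x).1
  have h2 : (gaussianReal 0 1).map (fun y => (s : ℝ) * y + m) = gaussianReal m (s ^ 2) := by
    have : (fun y => (s : ℝ) * y + m) = (fun y => y + m) ∘ fun y => (s : ℝ) * y := rfl
    rw [this, ← Measure.map_map (by fun_prop) (by fun_prop), gaussianReal_map_const_mul,
      gaussianReal_map_add_const, mul_zero, zero_add, mul_one]
    congr 1
  have hs' : (0 : ℝ) < s := hs
  rw [← h2, map_measureReal_apply (by fun_prop) measurableSet_Ioi,
    show (m - t) / (s : ℝ) = -((t - m) / s) by ring, ← h1]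
  congr 1
  ext y
  simp only [Set.mem_preimage, Set.mem_Ioi]
  rw [div_lt_iff₀ hs']
  constructor <;> intro h <;> linarith

lemma gaussianPDFReal_mul_le {m m' : ℝ} (hm : m ≤ m') (v : ℝ≥0) {t y : ℝ} (hty : t ≤ y) :
    gaussianPDFReal m' v t * gaussianPDFReal m v y
      ≤ gaussianPDFReal m' v y * gaussianPDFReal m v t := by
  simp only [gaussianPDFReal]
  have e : ∀ a b c : ℝ, a * Real.exp b * (a * Real.exp c) = a * a * Real.exp (b + c) := by
    intro a b c
    rw [Real.exp_add]
    ring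
  rw [e, e]
  refine mul_le_mul_of_nonneg_left (Real.exp_le_exp.2 ?_) (by positivity)
  rw [← add_div, ← add_div]
  refine div_le_div_of_nonneg_right ?_ (by positivity)
  nlinarith [mul_nonneg (sub_nonneg.2 hm) (sub_nonneg.2 hty)]

/-- The Neyman–Pearson lemma for two Gaussian laws. -/
lemma neyman_pearson {m m' : ℝ} (hm : m ≤ m') {v : ℝ≥0} (hv : v ≠ 0) {g : ℝ → ℝ}
    (hg : Measurable g) (h : ∀ y, g y ∈ Set.Icc 0 1) {t : ℝ}
    (h0 : ∫ y, g y ∂gaussianReal m v = (gaussianReal m v).real (Set.Ioi t)) :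
    ∫ y, g y ∂gaussianReal m' v ≤ (gaussianReal m' v).real (Set.Ioi t) := by
  set f : ℝ → ℝ := (Set.Ioi t).indicator 1 with hf
  have hfm : Measurable f := measurable_one.indicator measurableSet_Ioi
  have hf01 : ∀ y, f y ∈ Set.Icc (0 : ℝ) 1 := by
    intro y
    rw [hf, Set.indicator_apply]
    split_ifs <;> simp
  have hint : ∀ a, ∫ y, f y ∂gaussianReal a v = (gaussianReal a v).real (Set.Ioi t) := fun a =>
    integral_indicator_one measurableSet_Ioi
  rw [← hint] at h0 ⊢
  rw [integral_gaussianReal_eq_integral_smul hv, integral_gaussianReal_eq_integral_smul hv]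
    at h0 ⊢
  simp only [smul_eq_mul] at h0 ⊢
  have i0 := integrable_gaussianPDFReal_mul m v hg h
  have i1 := integrable_gaussianPDFReal_mul m' v hg h
  have j0 := integrable_gaussianPDFReal_mul m v hfm hf01
  have j1 := integrable_gaussianPDFReal_mul m' v hfm hf01
  have p0 := gaussianPDFReal_pos m v t hv
  set a := gaussianPDFReal m v t
  set b := gaussianPDFReal m' v t with hb
  -- The factors f - g and a f_{m'} - b f_m always have compatible signs, since the likelihood ratio
  -- is monotone and equals b/a at t.
  have key : 0 ≤ ∫ y, (a * (gaussianPDFReal m' v y * f y - gaussianPDFReal m' v y * g y)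
      - b * (gaussianPDFReal m v y * f y - gaussianPDFReal m v y * g y)) := by
    refine integral_nonneg fun y => ?_
    have e : a * (gaussianPDFReal m' v y * f y - gaussianPDFReal m' v y * g y)
      - b * (gaussianPDFReal m v y * f y - gaussianPDFReal m v y * g y)
      = (f y - g y) * (gaussianPDFReal m' v y * a - b * gaussianPDFReal m v y) := by ring
    simp only [Pi.zero_apply]
    rw [e]
    obtain ⟨g0, g1⟩ := h y
    by_cases hy : t < y
    · have hfy : f y = 1 := Set.indicator_of_mem (Set.mem_Ioi.2 hy) _
      rw [hfy]
      exact mul_nonneg (by linarith) (sub_nonneg.2 (gaussianPDFReal_mul_le hm v hy.le))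
    · have hfy : f y = 0 := Set.indicator_of_notMem hy _
      rw [hfy]
      refine mul_nonneg_of_nonpos_of_nonpos (by linarith) ?_
      have := gaussianPDFReal_mul_le hm v (not_lt.1 hy)
      linarith
  have k1 : Integrable fun y => a * (gaussianPDFReal m' v y * f y - gaussianPDFReal m' v y * g y) :=
    (j1.sub i1).const_mul _
  have k0 : Integrable fun y => b * (gaussianPDFReal m v y * f y - gaussianPDFReal m v y * g y) :=
    (j0.sub i0).const_mul _
  rw [integral_sub k1 k0, integral_const_mul,
    integral_const_mul, integral_sub j1 i1, integral_sub j0 i0, h0, sub_self, mul_zero,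
    sub_zero] at key
  exact sub_nonneg.1 (nonneg_of_mul_nonneg_right key p0)

lemma exists_stdCDF_eq {a : ℝ} (h0 : 0 < a) (h1 : a < 1) : ∃ x, stdCDF x = a := by
  have hlim := tendsto_stdCDF_atTop
  obtain ⟨b, hb⟩ := (hlim.eventually (eventually_ge_nhds h1)).exists
  obtain ⟨c, hc⟩ := (hlim.eventually (eventually_ge_nhds (show 1 - a < 1 by linarith))).exists
  refine mem_range_of_exists_le_of_exists_ge continuous_stdCDF ⟨-c, ?_⟩ ⟨b, hb⟩
  rw [stdCDF_neg]
  linarith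

/-- Half the distance of the means of the private signals in units of the standard deviation. -/
def halfDist (σ : ℝ≥0) : ℝ := 1 / (2 * σ)

/-- The second moment of the likelihood ratio of a private signal. -/
def secondMoment (σ : ℝ≥0) : ℝ := Real.exp (1 / (σ : ℝ) ^ 2)

lemma one_le_secondMoment (σ : ℝ≥0) : 1 ≤ secondMoment σ := Real.one_le_exp (by positivity)

lemma sq_integral_signalLaw_le {σ : ℝ≥0} (hσ : 0 < σ) {g : ℝ → ℝ} (hg : Measurable g)
    (h : ∀ y, g y ∈ Set.Icc 0 1) {i j : Bool} (hij : i ≠ j) :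
    (∫ y, g y ∂signalLaw σ i) ^ 2 ≤ secondMoment σ * ∫ y, g y ∂signalLaw σ j := by
  have := sq_integral_gaussianReal_le (hypValue j) (hypValue i) (pow_pos hσ 2).ne' hg h
  rw [signalLaw, signalLaw, secondMoment]
  convert this using 4
  · cases i <;> cases j <;> simp_all [hypValue]
  · simp

lemma integral_one_sub {Ω : Type*} {mΩ : MeasurableSpace Ω} {μ : Measure Ω}
    [IsProbabilityMeasure μ] {g : Ω → ℝ} (hg : Measurable g) (h : ∀ y, g y ∈ Set.Icc 0 1) :
    ∫ y, (1 - g y) ∂μ = 1 - ∫ y, g y ∂μ := by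
  rw [integral_sub (integrable_const 1) (integrable_of_mem_Icc hg h)]
  simp

lemma integral_mem_Icc {Ω : Type*} {mΩ : MeasurableSpace Ω} {μ : Measure Ω}
    [IsProbabilityMeasure μ] {g : Ω → ℝ} (hg : Measurable g) (h : ∀ y, g y ∈ Set.Icc 0 1) :
    ∫ y, g y ∂μ ∈ Set.Icc (0 : ℝ) 1 := by
  refine ⟨integral_nonneg fun y => (h y).1, ?_⟩
  have h1 := integral_one_sub (μ := μ) hg h
  have h2 : 0 ≤ ∫ y, (1 - g y) ∂μ := integral_nonneg fun y => sub_nonneg.2 (h y).2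
  linarith

lemma exists_tilt_of_le {σ : ℝ≥0} (hσ : 0 < σ) {g : ℝ → ℝ} (hg : Measurable g)
    (h : ∀ y, g y ∈ Set.Icc 0 1) {α δ : ℝ} (hα : α = ∫ y, g y ∂signalLaw σ false)
    (hδ : δ = ∫ y, g y ∂signalLaw σ true) (hle : α ≤ δ) :
    ∃ r, α ≤ r ∧ r ≤ δ ∧ klBer r α ≤ symExponent (halfDist σ) ∧
      klBer r δ ≤ symExponent (halfDist σ) := by
  have hψ := symExponent_nonneg (halfDist σ)
  have hα01 : α ∈ Set.Icc (0 : ℝ) 1 := by rw [hα]; exact integral_mem_Icc hg h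
  have hδ01 : δ ∈ Set.Icc (0 : ℝ) 1 := by rw [hδ]; exact integral_mem_Icc hg h
  have hsq : δ ^ 2 ≤ secondMoment σ * α := by
    rw [hα, hδ]; exact sq_integral_signalLaw_le hσ hg h (by decide)
  rcases hα01.1.eq_or_lt with h0 | h0
  · have : δ = 0 := by rw [← h0] at hsq; nlinarith
    refine ⟨α, le_rfl, hle, ?_, ?_⟩
    · rwa [klBer_self]
    · rw [this, ← h0, klBer_self]; exact hψ
  rcases hα01.2.eq_or_lt with h1 | h1
  · have : δ = α := by linarith [hδ01.2]
    refine ⟨α, le_rfl, hle, ?_, ?_⟩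
    · rwa [klBer_self]
    · rwa [this, klBer_self]
  have hσ' : (0 : ℝ) < σ := hσ
  have hh : 0 < halfDist σ := by rw [halfDist]; positivity
  obtain ⟨x, hx⟩ := exists_stdCDF_eq h0 h1
  have hx0 : (hypValue false - -(x * σ)) / σ = x := by
    simp only [hypValue]
    norm_num
    field_simp
  have hx1 : (hypValue true - -(x * σ)) / σ = x + halfDist σ + halfDist σ := by
    simp only [hypValue, halfDist]
    norm_num
    field_simp
    ring
  -- The threshold -xσ has the same false alarm probability α as g.
  have hNP : δ ≤ stdCDF (x + halfDist σ + halfDist σ) := by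
    rw [← hx1, ← gaussianReal_real_Ioi _ hσ, hδ]
    refine neyman_pearson (m := hypValue false) (by simp [hypValue]) (pow_pos hσ 2).ne' hg h ?_
    rw [gaussianReal_real_Ioi _ hσ, hx0, hx, hα, signalLaw]
  obtain ⟨r, r1, r2, r3, r4⟩ := exists_klBer_le hh (x + halfDist σ)
  rw [add_sub_cancel_right, hx] at r1 r3
  have hlt := stdCDF_lt_one (x + halfDist σ + halfDist σ)
  -- If the law for the threshold test overshoots δ, then δ itself serves, at relative entropy 0
  -- from the second law.
  rcases le_total r δ with hr | hr
  · exact ⟨r, r1, hr, r3, (klBer_le_klBer_right (h0.le.trans r1) hr (h0.trans_le hle) hNP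
      hlt).trans r4⟩
  · refine ⟨δ, hle, le_rfl, (klBer_le_klBer_left h0 hle hr (by linarith)).trans r3, ?_⟩
    rwa [klBer_self]

/-- Every binary quantization of a private signal admits a Bernoulli law whose relative entropies
to both laws of the quantized signal are at most the exponent of the symmetric threshold test. -/
lemma exists_tilt {σ : ℝ≥0} (hσ : 0 < σ) {g : ℝ → ℝ} (hg : Measurable g)
    (h : ∀ y, g y ∈ Set.Icc 0 1) (p : Bool → ℝ) (hp : ∀ i, p i = ∫ y, g y ∂signalLaw σ i) :
    ∃ r ∈ Set.Icc (0 : ℝ) 1, ∀ i, klBer r (p i) ≤ symExponent (halfDist σ) ∧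
      r * (Real.log r - Real.log (p i)) ^ 2
        + (1 - r) * (Real.log (1 - r) - Real.log (1 - p i)) ^ 2 ≤ 8 * secondMoment σ ∧
      (p i = 0 → r = 0) ∧ (p i = 1 → r = 1) := by
  have key : ∀ {g : ℝ → ℝ}, Measurable g → (∀ y, g y ∈ Set.Icc 0 1) → ∀ {α δ : ℝ},
      α = ∫ y, g y ∂signalLaw σ false → δ = ∫ y, g y ∂signalLaw σ true → α ≤ δ →
      ∃ r ∈ Set.Icc (0 : ℝ) 1, ∀ p, (p = α ∨ p = δ) → klBer r p ≤ symExponent (halfDist σ) ∧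
      r * (Real.log r - Real.log p) ^ 2
        + (1 - r) * (Real.log (1 - r) - Real.log (1 - p)) ^ 2 ≤ 8 * secondMoment σ ∧
      (p = 0 → r = 0) ∧ (p = 1 → r = 1) := by
    intro g hg h α δ hα hδ hle
    obtain ⟨r, r1, r2, r3, r4⟩ := exists_tilt_of_le hσ hg h hα hδ hle
    have hα01 : α ∈ Set.Icc (0 : ℝ) 1 := by rw [hα]; exact integral_mem_Icc hg h
    have hδ01 : δ ∈ Set.Icc (0 : ℝ) 1 := by rw [hδ]; exact integral_mem_Icc hg h
    have hM := one_le_secondMoment σ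
    have s1 : δ ^ 2 ≤ secondMoment σ * α := by
      rw [hα, hδ]; exact sq_integral_signalLaw_le hσ hg h (by decide)
    have s2 : (1 - α) ^ 2 ≤ secondMoment σ * (1 - δ) := by
      rw [hα, hδ, ← integral_one_sub hg h, ← integral_one_sub hg h]
      exact sq_integral_signalLaw_le hσ (hg.const_sub 1)
        (fun y => ⟨sub_nonneg.2 (h y).2, by linarith [(h y).1]⟩) (by decide)
    obtain ⟨a1, a2⟩ := mul_log_sub_log_sq_le hM hα01.1 r1 r2 hδ01.2 s1
    obtain ⟨b1, b2⟩ := mul_log_sub_log_sq_le hM (sub_nonneg.2 hδ01.2)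
      (sub_le_sub_left r2 1) (sub_le_sub_left r1 1) (by linarith [hα01.1]) s2
    refine ⟨r, ⟨hα01.1.trans r1, r2.trans hδ01.2⟩, ?_⟩
    rintro p (rfl | rfl)
    · refine ⟨r3, by linarith, fun h0 => ?_, fun h1 => by linarith [hδ01.2]⟩
      rw [h0, mul_zero] at s1
      nlinarith
    · refine ⟨r4, by linarith, fun h0 => by linarith [hα01.1], fun h1 => ?_⟩
      rw [h1, sub_self, mul_zero] at s2
      nlinarith
  -- If g favours the wrong hypothesis, exchange the two decisions.
  rcases le_total (p false) (p true) with hle | hle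
  · obtain ⟨r, hr, H⟩ := key hg h (hp false) (hp true) hle
    refine ⟨r, hr, fun i => H _ ?_⟩
    cases i <;> simp
  · obtain ⟨r, hr, H⟩ := key (g := fun y => 1 - g y) (α := 1 - p false) (δ := 1 - p true)
      (hg.const_sub 1) (fun y => ⟨sub_nonneg.2 (h y).2, by linarith [(h y).1]⟩)
      (by rw [integral_one_sub hg h, hp]) (by rw [integral_one_sub hg h, hp])
      (by linarith)
    refine ⟨1 - r, ⟨sub_nonneg.2 hr.2, by linarith [hr.1]⟩, fun i => ?_⟩
    obtain ⟨h1, h2, h3, h4⟩ := H (1 - p i) (by cases i <;> simp)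
    rw [sub_sub_cancel] at h2
    refine ⟨?_, ?_, fun h => ?_, fun h => ?_⟩
    · rwa [← klBer_compl, sub_sub_cancel]
    · rw [sub_sub_cancel]; linarith
    · rw [h4 (by rw [h, sub_zero]), sub_self]
    · rw [h3 (by rw [h, sub_self]), sub_zero]

/-! ### A lower bound for the overlap of two product laws -/

lemma pi_real_singleton {N : ℕ} (μ : Fin N → Measure Bool) [∀ i, IsProbabilityMeasure (μ i)]
    (x : Fin N → Bool) : (Measure.pi μ).real {x} = ∏ i, (μ i).real {x i} := by
  rw [measureReal_def, ← Set.univ_pi_singleton, Measure.pi_pi, ENNReal.toReal_prod]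
  rfl

/-- The log-likelihood ratio of a law `μ` on `Bool` and the weights `p`. -/
def logRatio (μ : Measure Bool) (p : Bool → ℝ) (b : Bool) : ℝ :=
  Real.log (μ.real {b}) - Real.log (p b)

lemma integral_sum_logRatio_le {N : ℕ} (μ : Fin N → Measure Bool)
    [∀ i, IsProbabilityMeasure (μ i)] {p : Fin N → Bool → ℝ} {ψ : ℝ}
    (hE : ∀ i, ∫ b, logRatio (μ i) (p i) b ∂μ i ≤ ψ) :
    ∫ x, ∑ i, logRatio (μ i) (p i) (x i) ∂Measure.pi μ ≤ N * ψ := by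
  rw [integral_finsetSum _ fun i _ => Integrable.of_finite]
  calc ∑ i, ∫ x, logRatio (μ i) (p i) (x i) ∂Measure.pi μ
      = ∑ i, ∫ b, logRatio (μ i) (p i) b ∂μ i := by
        refine Finset.sum_congr rfl fun i _ => ?_
        generalize logRatio (μ i) (p i) = f
        conv_rhs => rw [← (measurePreserving_eval μ i).map_eq]
        rw [integral_map (measurable_pi_apply i).aemeasurable
          Measurable.of_discrete.aestronglyMeasurable]
    _ ≤ ∑ _i : Fin N, ψ := Finset.sum_le_sum fun i _ => hE i
    _ = N * ψ := by simp

lemma integral_abs_sub_le {N : ℕ} (hN : 0 < N) (μ : Fin N → Measure Bool)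
    [∀ i, IsProbabilityMeasure (μ i)] {p : Fin N → Bool → ℝ} {K : ℝ}
    (hK : ∀ i, ∫ b, logRatio (μ i) (p i) b ^ 2 ∂μ i ≤ K) :
    ∫ x, |∑ i, logRatio (μ i) (p i) (x i)
      - ∫ y, ∑ i, logRatio (μ i) (p i) (y i) ∂Measure.pi μ| ∂Measure.pi μ
      ≤ (K + 1) * √N / 2 := by
  set V := Measure.pi μ
  set L : (Fin N → Bool) → ℝ := fun x => ∑ i, logRatio (μ i) (p i) (x i) with hL
  have hvar : Var[L; V] ≤ N * K := by
    have h1 : L = ∑ i, fun x : Fin N → Bool => logRatio (μ i) (p i) (x i) := by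
      ext x
      simp [hL]
    rw [h1, variance_sum_pi (X := fun i => logRatio (μ i) (p i)) fun i => MemLp.of_discrete]
    calc ∑ i, Var[logRatio (μ i) (p i); μ i] ≤ ∑ _i : Fin N, K :=
          Finset.sum_le_sum fun i _ => (variance_le_expectation_sq
            Measurable.of_discrete.aestronglyMeasurable).trans (hK i)
      _ = N * K := by simp
  have hs : 0 < √(N : ℝ) := Real.sqrt_pos.2 (by exact_mod_cast hN)
  have hss : √(N : ℝ) * √N = N := Real.mul_self_sqrt (by positivity)
  rw [variance_eq_integral Measurable.of_discrete.aemeasurable] at hvar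
  calc ∫ x, |L x - ∫ y, L y ∂V| ∂V
      ≤ ∫ x, ((2 * √(N : ℝ))⁻¹ * (L x - ∫ y, L y ∂V) ^ 2 + √N / 2) ∂V := by
        refine integral_mono Integrable.of_finite Integrable.of_finite fun x => ?_
        simp only
        set w := L x - ∫ y, L y ∂V
        rw [← sub_nonneg, ← sq_abs]
        -- The inequality |w| ≤ w²/(2√N) + √N/2 trades the mean absolute deviation for the variance,
        -- of order N.
        have : (2 * √(N : ℝ))⁻¹ * |w| ^ 2 + √N / 2 - |w| = (2 * √(N : ℝ))⁻¹ * (|w| - √N) ^ 2 := by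
          field_simp
          ring
        rw [this]
        positivity
    _ = (2 * √(N : ℝ))⁻¹ * (∫ x, (L x - ∫ y, L y ∂V) ^ 2 ∂V) + √N / 2 := by
        rw [integral_add Integrable.of_finite Integrable.of_finite, integral_const_mul]
        simp
    _ ≤ (2 * √(N : ℝ))⁻¹ * (N * K) + √N / 2 := by gcongr
    _ = (K + 1) * √N / 2 := by
        rw [show (N : ℝ) * K = √N * (√N * K) by rw [← mul_assoc, hss]]
        field_simp

/-- Change of measure to the product of the μ i: the sum is at least the mean of exp(-max(L₀, L₁))
for the log-likelihood ratios L₀, L₁, and the maximum exceeds Nψ on average by at most their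
absolute deviations. -/
lemma exp_neg_le_sum_min {N : ℕ} (hN : 0 < N) (μ : Fin N → Measure Bool)
    [∀ i, IsProbabilityMeasure (μ i)] (p : Bool → Fin N → Bool → ℝ) {ψ K : ℝ}
    (hp : ∀ h i b, 0 ≤ p h i b) (hsupp : ∀ h i b, p h i b = 0 → (μ i).real {b} = 0)
    (hE : ∀ h i, ∫ b, logRatio (μ i) (p h i) b ∂μ i ≤ ψ)
    (hK : ∀ h i, ∫ b, logRatio (μ i) (p h i) b ^ 2 ∂μ i ≤ K) :
    Real.exp (-(N * ψ + (K + 1) * √N))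
      ≤ ∑ x : Fin N → Bool, min (∏ i, p false i (x i)) (∏ i, p true i (x i)) := by
  set V := Measure.pi μ with hV
  set L : Bool → (Fin N → Bool) → ℝ := fun h x => ∑ i, logRatio (μ i) (p h i) (x i) with hL
  set Z : (Fin N → Bool) → ℝ := fun x => max (L false x) (L true x) with hZ
  set c := N * ψ + (K + 1) * √N with hc
  have hmean : ∀ h, ∫ x, L h x ∂V ≤ N * ψ := fun h => integral_sum_logRatio_le μ (hE h)
  have habs : ∀ h, ∫ x, |L h x - ∫ y, L h y ∂V| ∂V ≤ (K + 1) * √N / 2 := fun h =>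
    integral_abs_sub_le hN μ (hK h)
  have hEZ : ∫ x, Z x ∂V ≤ c := by
    calc ∫ x, Z x ∂V ≤ ∫ x, (N * ψ + |L false x - ∫ y, L false y ∂V|
          + |L true x - ∫ y, L true y ∂V|) ∂V := by
          refine integral_mono Integrable.of_finite Integrable.of_finite fun x => ?_
          have := hmean false
          have := hmean true
          have := le_abs_self (L false x - ∫ y, L false y ∂V)
          have := le_abs_self (L true x - ∫ y, L true y ∂V)
          have := abs_nonneg (L false x - ∫ y, L false y ∂V)
          have := abs_nonneg (L true x - ∫ y, L true y ∂V)
          exact max_le (by linarith) (by linarith)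
      _ = N * ψ + ∫ x, |L false x - ∫ y, L false y ∂V| ∂V
          + ∫ x, |L true x - ∫ y, L true y ∂V| ∂V := by
          rw [integral_add Integrable.of_finite Integrable.of_finite,
            integral_add Integrable.of_finite Integrable.of_finite]
          simp
      _ ≤ c := by
          have := habs false
          have := habs true
          linarith
  -- The tangent of exp(-z) at z = c, integrated; no concentration inequality is needed.
  have hJ : Real.exp (-c) ≤ ∫ x, Real.exp (-Z x) ∂V := by
    calc Real.exp (-c) ≤ Real.exp (-c) * (1 + c - ∫ x, Z x ∂V) :=
          le_mul_of_one_le_right (Real.exp_pos _).le (by linarith)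
      _ = ∫ x, Real.exp (-c) * (1 + c - Z x) ∂V := by
          rw [integral_const_mul, integral_sub Integrable.of_finite Integrable.of_finite]
          simp
      _ ≤ ∫ x, Real.exp (-Z x) ∂V := by
          refine integral_mono Integrable.of_finite Integrable.of_finite fun x => ?_
          simp only
          rw [show -Z x = -c + (c - Z x) by ring, Real.exp_add]
          refine mul_le_mul_of_nonneg_left ?_ (Real.exp_pos _).le
          linarith [Real.add_one_le_exp (c - Z x)]
  refine hJ.trans ?_
  rw [integral_fintype Integrable.of_finite]
  refine Finset.sum_le_sum fun x _ => ?_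
  rw [smul_eq_mul, hV, pi_real_singleton]
  have hle : ∀ h, (∏ i, (μ i).real {x i}) * Real.exp (-Z x) ≤ ∏ i, p h i (x i) := by
    intro h
    -- Points of zero mass under the product law are treated apart, because the convention log 0 = 0
    -- makes Z meaningless there.
    by_cases h0 : ∃ i, (μ i).real {x i} = 0
    · obtain ⟨i, hi⟩ := h0
      rw [Finset.prod_eq_zero (Finset.mem_univ i) hi, zero_mul]
      exact Finset.prod_nonneg fun i _ => hp h i _
    · push Not at h0
      have hμ : ∀ i, 0 < (μ i).real {x i} := fun i => lt_of_le_of_ne measureReal_nonneg (h0 i).symm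
      have hpp : ∀ i, 0 < p h i (x i) := fun i =>
        lt_of_le_of_ne (hp h i _) fun h' => h0 i (hsupp h i _ h'.symm)
      have hLZ : L h x ≤ Z x := by
        cases h
        · exact le_max_left _ _
        · exact le_max_right _ _
      calc (∏ i, (μ i).real {x i}) * Real.exp (-Z x)
          ≤ (∏ i, (μ i).real {x i}) * Real.exp (-L h x) := by
            have := Finset.prod_nonneg fun i (_ : i ∈ Finset.univ) => (hμ i).le
            gcongr
        _ = ∏ i, p h i (x i) := by
            rw [hL, ← Finset.sum_neg_distrib, Real.exp_sum, ← Finset.prod_mul_distrib]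
            refine Finset.prod_congr rfl fun i _ => ?_
            rw [logRatio, neg_sub, Real.exp_sub, Real.exp_log (hμ i), Real.exp_log (hpp i),
              mul_div_cancel₀ _ (hμ i).ne']
  exact le_min (hle false) (hle true)

/-! ### The laws of the decisions -/

lemma bind_real {α β : Type*} {mα : MeasurableSpace α} {mβ : MeasurableSpace β}
    (κ : Kernel α β) [IsMarkovKernel κ] (μ : Measure α) {s : Set β} (hs : MeasurableSet s) :
    (κ ∘ₘ μ).real s = ∫ a, (κ a).real s ∂μ := by
  rw [measureReal_def, Measure.bind_apply hs κ.aemeasurable]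
  exact (integral_toReal (κ.measurable_coe hs).aemeasurable
    (.of_forall fun a => measure_lt_top _ _)).symm

lemma measurable_kernel_real {α β : Type*} {mα : MeasurableSpace α} {mβ : MeasurableSpace β}
    (κ : Kernel α β) {s : Set β} (hs : MeasurableSet s) : Measurable fun a => (κ a).real s :=
  (κ.measurable_coe hs).ennreal_toReal

lemma isProbabilityMeasure_localLaw (σ : ℝ≥0) (κ : Kernel ℝ Bool) [IsMarkovKernel κ] (h : Bool) :
    IsProbabilityMeasure (localLaw σ κ h) := by
  unfold localLaw; infer_instance

lemma real_singleton_false {μ : Measure Bool} [IsProbabilityMeasure μ] :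
    μ.real {false} = 1 - μ.real {true} := by
  rw [← probReal_compl_eq_one_sub (measurableSet_singleton true)]
  congr 1
  ext b
  cases b <;> simp

lemma measureReal_mem_Icc {Ω : Type*} {mΩ : MeasurableSpace Ω} (μ : Measure Ω)
    [IsProbabilityMeasure μ] (s : Set Ω) : μ.real s ∈ Set.Icc (0 : ℝ) 1 :=
  ⟨measureReal_nonneg, measureReal_le_one⟩

/-- The law of the decision of the fusion agent, given the hypothesis, by conditioning on the local
decisions. -/
lemma fusionLaw_real (σ : ℝ≥0) {N : ℕ} (D : DecisionRules N) (h b : Bool) :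
    (fusionLaw σ D h).real {b} = ∑ x : Fin N → Bool,
      (∏ i, (localLaw σ (D.loc i) h).real {x i}) * ∫ y, (D.fus (y, x)).real {b} ∂signalLaw σ h := by
  have := D.fus_markov
  have := D.loc_markov
  have := fun i => isProbabilityMeasure_localLaw σ (D.loc i) h
  have hm := measurable_kernel_real D.fus (measurableSet_singleton b)
  rw [fusionLaw, bind_real _ _ (measurableSet_singleton b), integral_prod_symm _
    (integrable_of_mem_Icc hm fun z => measureReal_mem_Icc _ _), integral_fintype
    Integrable.of_finite]
  simp_rw [pi_real_singleton, smul_eq_mul]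

lemma bernoulli_real_true (r : unitInterval) :
    (bernoulliMeasure true false r).real {true} = r := by
  rw [bernoulliMeasure_real_apply_of_mem_of_notMem _ (measurableSet_singleton _) rfl (by simp)]

lemma integral_bool {μ : Measure Bool} [IsProbabilityMeasure μ] (f : Bool → ℝ) :
    ∫ b, f b ∂μ = μ.real {true} * f true + (1 - μ.real {true}) * f false := by
  rw [integral_fintype Integrable.of_finite, Fintype.sum_bool, real_singleton_false]
  rfl

/-- The overlap of the laws of the local decisions under the two hypotheses. -/
lemma exp_neg_le_sum_min_localLaw {σ : ℝ≥0} (hσ : 0 < σ) {N : ℕ} (hN : 0 < N)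
    (D : DecisionRules N) :
    Real.exp (-(N * symExponent (halfDist σ) + (8 * secondMoment σ + 1) * √N))
      ≤ ∑ x : Fin N → Bool, min (∏ i, (localLaw σ (D.loc i) false).real {x i})
        (∏ i, (localLaw σ (D.loc i) true).real {x i}) := by
  have := D.loc_markov
  have := fun i h => isProbabilityMeasure_localLaw σ (D.loc i) h
  have htilt := fun i => exists_tilt hσ
    (measurable_kernel_real (D.loc i) (measurableSet_singleton true))
    (fun y => measureReal_mem_Icc _ _) (fun h => (localLaw σ (D.loc i) h).real {true})
    (fun h => bind_real (D.loc i) _ (measurableSet_singleton true))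
  choose r hr H using htilt
  set μ : Fin N → Measure Bool := fun i => bernoulliMeasure true false ⟨r i, hr i⟩ with hμ
  have : ∀ i, IsProbabilityMeasure (μ i) := fun i => by rw [hμ]; infer_instance
  have hμt : ∀ i, (μ i).real {true} = r i := fun i => bernoulli_real_true _
  refine exp_neg_le_sum_min hN μ (fun h i b => (localLaw σ (D.loc i) h).real {b})
    (fun _ _ _ => measureReal_nonneg) ?_ ?_ ?_
  · rintro h i (_ | _) h0
    · rw [real_singleton_false] at h0 ⊢
      rw [hμt, (H i h).2.2.2 (by linarith), sub_self]
    · rw [hμt]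
      exact (H i h).2.2.1 h0
  · intro h i
    rw [integral_bool, logRatio, logRatio, real_singleton_false, real_singleton_false, hμt]
    exact (H i h).1
  · intro h i
    rw [integral_bool, logRatio, logRatio, real_singleton_false, real_singleton_false, hμt]
    exact (H i h).2.1

/-- The total error probability of a test between the two laws of a private signal is bounded
away from `0`. -/
lemma le_integral_add_integral {σ : ℝ≥0} (hσ : 0 < σ) (κ : Kernel ℝ Bool) [IsMarkovKernel κ] :
    3 / (4 * secondMoment σ) ≤ ∫ y, (κ y).real {true} ∂signalLaw σ false
      + ∫ y, (κ y).real {false} ∂signalLaw σ true := by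
  have hm := measurable_kernel_real κ (measurableSet_singleton true)
  have h1 := sq_integral_signalLaw_le hσ hm (fun y => measureReal_mem_Icc _ _)
    (show true ≠ false by decide)
  have h2 : ∫ y, (κ y).real {false} ∂signalLaw σ true
      = 1 - ∫ y, (κ y).real {true} ∂signalLaw σ true := by
    rw [← integral_one_sub hm fun y => measureReal_mem_Icc _ _]
    simp_rw [real_singleton_false]
  rw [h2]
  have hM := one_le_secondMoment σ
  have h3 := (integral_mem_Icc (μ := signalLaw σ true) hm fun y => measureReal_mem_Icc _ _).2
  rw [div_le_iff₀ (by linarith)]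
  -- With a the integral here, the sum of errors is at least a²/M + 1 - a ≥ (a² - a + 1)/M, and a² -
  -- a + 1 ≥ 3/4.
  nlinarith [sq_nonneg ((∫ y, (κ y).real {true} ∂signalLaw σ true) - 1 / 2)]

/-- The non-asymptotic converse. -/
lemma le_bayesRisk {σ : ℝ≥0} (hσ : 0 < σ) {cFA cMD π₀ : ℝ} (hFA : 0 < cFA) (hMD : 0 < cMD)
    (hπ₀ : 0 < π₀) (hπ₁ : π₀ < 1) {N : ℕ} (hN : 0 < N) (D : DecisionRules N) :
    min (cFA * π₀) (cMD * (1 - π₀)) * (3 / (4 * secondMoment σ))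
      * Real.exp (-(N * symExponent (halfDist σ) + (8 * secondMoment σ + 1) * √N))
      ≤ bayesRisk σ cFA cMD π₀ D := by
  have := D.fus_markov
  set m := min (cFA * π₀) (cMD * (1 - π₀)) with hm
  have hm0 : 0 < m := lt_min (by positivity) (mul_pos hMD (by linarith))
  set η := 3 / (4 * secondMoment σ)
  have hη : 0 < η := div_pos (by norm_num) (by linarith [one_le_secondMoment σ])
  set p : Bool → (Fin N → Bool) → ℝ := fun h x => ∏ i, (localLaw σ (D.loc i) h).real {x i}
  have hp : ∀ h x, 0 ≤ p h x := fun h x => Finset.prod_nonneg fun i _ => measureReal_nonneg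
  have hsum : η * ∑ x, min (p false x) (p true x)
      ≤ (fusionLaw σ D false).real {true} + (fusionLaw σ D true).real {false} := by
    rw [fusionLaw_real, fusionLaw_real, Finset.mul_sum, ← Finset.sum_add_distrib]
    refine Finset.sum_le_sum fun x _ => ?_
    -- For fixed local decisions x the fusion rule is a test based on its private signal alone.
    have h1 := le_integral_add_integral hσ (D.fus.comap (fun y => (y, x)) (by fun_prop))
    simp only [Kernel.comap_apply] at h1
    have i0 : 0 ≤ ∫ y, (D.fus (y, x)).real {true} ∂signalLaw σ false :=
      integral_nonneg fun y => measureReal_nonneg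
    have i1 : 0 ≤ ∫ y, (D.fus (y, x)).real {false} ∂signalLaw σ true :=
      integral_nonneg fun y => measureReal_nonneg
    have h2 := mul_le_mul_of_nonneg_right (min_le_left (p false x) (p true x)) i0
    have h3 := mul_le_mul_of_nonneg_right (min_le_right (p false x) (p true x)) i1
    have h4 := mul_le_mul_of_nonneg_left h1 (le_min (hp false x) (hp true x))
    rw [mul_comm η]
    linarith
  have h1 := mul_le_mul_of_nonneg_left (exp_neg_le_sum_min_localLaw hσ hN D) hη.le
  have h2 := mul_le_mul_of_nonneg_left (h1.trans hsum) hm0.le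
  rw [mul_assoc]
  refine h2.trans ?_
  rw [mul_add, bayesRisk]
  have e0 : 0 ≤ (fusionLaw σ D false).real {true} := measureReal_nonneg
  have e1 : 0 ≤ (fusionLaw σ D true).real {false} := measureReal_nonneg
  exact add_le_add (mul_le_mul_of_nonneg_right (min_le_left _ _) e0)
    (mul_le_mul_of_nonneg_right (min_le_right _ _) e1)

/-! ### Networks in which all agents have the same belief -/

lemma threshold_eq_one {cFA cMD : ℝ} (hFA : 0 < cFA) (hMD : 0 < cMD) :
    cFA * (cMD / (cFA + cMD)) / (cMD * (1 - cMD / (cFA + cMD))) = 1 := by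
  have : cFA + cMD ≠ 0 := by positivity
  have h : 1 - cMD / (cFA + cMD) = cFA / (cFA + cMD) := by field_simp; ring
  rw [h]
  field_simp

lemma one_lt_likelihoodRatio_iff {σ : ℝ≥0} (hσ : 0 < σ) (y : ℝ) :
    1 < likelihoodRatio σ y ↔ 1 / 2 < y := by
  have hv : (0 : ℝ) < ↑(σ ^ 2) := by exact_mod_cast pow_pos hσ 2
  have hσ2 : σ ^ 2 ≠ 0 := (pow_pos hσ 2).ne'
  have hc : 0 < (√(2 * Real.pi * ↑(σ ^ 2)))⁻¹ := by
    have := Real.pi_pos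
    positivity
  rw [likelihoodRatio, signalPDF, signalPDF, one_lt_div (gaussianPDFReal_pos _ _ _ hσ2),
    gaussianPDFReal, gaussianPDFReal, mul_lt_mul_iff_right₀ hc, Real.exp_lt_exp,
    div_lt_div_iff_of_pos_right (by positivity)]
  simp only [hypValue]
  norm_num
  constructor <;> intro h <;> nlinarith

lemma localDecision_eq_true_iff {σ : ℝ≥0} (hσ : 0 < σ) {cFA cMD : ℝ} (hFA : 0 < cFA)
    (hMD : 0 < cMD) (y : ℝ) :
    localDecision σ cFA cMD (cMD / (cFA + cMD)) y = true ↔ 1 / 2 < y := by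
  rw [localDecision, threshold_eq_one hFA hMD, ← one_lt_likelihoodRatio_iff hσ]
  simp

lemma dirac_real_singleton (a b : Bool) :
    (Measure.dirac a).real {b} = if a = b then 1 else 0 := by
  rw [measureReal_def, Measure.dirac_apply' _ (measurableSet_singleton b), Set.indicator_apply]
  split_ifs <;> simp_all

lemma localLaw_localKernel_true {σ : ℝ≥0} (hσ : 0 < σ) {cFA cMD : ℝ} (hFA : 0 < cFA)
    (hMD : 0 < cMD) (h : Bool) :
    (localLaw σ (localKernel σ cFA cMD (cMD / (cFA + cMD))) h).real {true}
      = stdCDF (if h then halfDist σ else -halfDist σ) := by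
  rw [localKernel, localLaw, bind_real _ _ (measurableSet_singleton true)]
  have h1 : ∀ y, ((Kernel.deterministic (localDecision σ cFA cMD (cMD / (cFA + cMD)))
      (measurable_localDecision σ cFA cMD _)) y).real {true}
      = (Set.Ioi (1 / 2 : ℝ)).indicator 1 y := by
    intro y
    rw [Kernel.deterministic_apply, dirac_real_singleton, Set.indicator_apply]
    simp only [localDecision_eq_true_iff hσ hFA hMD, Set.mem_Ioi, Pi.one_apply]
  simp_rw [h1]
  rw [integral_indicator_one measurableSet_Ioi, signalLaw, gaussianReal_real_Ioi _ hσ]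
  have hσ' : (σ : ℝ) ≠ 0 := by exact_mod_cast hσ.ne'
  congr 1
  cases h <;> simp only [hypValue, halfDist] <;> norm_num <;> field_simp

lemma exp_neg_symExponent (h : ℝ) :
    Real.exp (-symExponent h) = 2 * √(stdCDF h * stdCDF (-h)) := by
  have h1 := mul_pos (stdCDF_pos h) (stdCDF_pos (-h))
  have h2 : -symExponent h = Real.log (2 * √(stdCDF h * stdCDF (-h))) := by
    rw [Real.log_mul two_ne_zero (Real.sqrt_pos.2 h1).ne', Real.log_sqrt h1.le,
      Real.log_mul (stdCDF_pos h).ne' (stdCDF_pos _).ne', symExponent]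
    ring
  rw [h2, Real.exp_log (by positivity)]

/-- The minimum is at most the geometric mean, and the sum of the geometric means factorizes over
the agents. -/
lemma sum_min_prod_le {N : ℕ} (p q : Bool → ℝ) (hp : ∀ b, 0 ≤ p b) (hq : ∀ b, 0 ≤ q b) :
    ∑ x : Fin N → Bool, min (∏ i, p (x i)) (∏ i, q (x i)) ≤ (∑ b, √(p b * q b)) ^ N := by
  have h1 : (∑ b, √(p b * q b)) ^ N = ∑ x : Fin N → Bool, ∏ i, √(p (x i) * q (x i)) := by
    rw [← Fintype.prod_sum (fun (_ : Fin N) b => √(p b * q b))]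
    simp
  rw [h1]
  refine Finset.sum_le_sum fun x _ => ?_
  have hP : 0 ≤ ∏ i, p (x i) := Finset.prod_nonneg fun i _ => hp _
  have hQ : 0 ≤ ∏ i, q (x i) := Finset.prod_nonneg fun i _ => hq _
  refine (le_abs_self _).trans (abs_le_of_sq_le_sq ?_ (Finset.prod_nonneg fun i _ =>
    Real.sqrt_nonneg _))
  rw [← Finset.prod_pow, Finset.prod_congr rfl fun i _ =>
    Real.sq_sqrt (mul_nonneg (hp (x i)) (hq (x i))), Finset.prod_mul_distrib, sq]
  exact mul_le_mul (min_le_left _ _) (min_le_right _ _) (le_min hP hQ) hP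

lemma mul_integral_le_of_pointwise {σ : ℝ≥0} (hσ : 0 < σ) {i j : Bool} {a b : ℝ} {g : ℝ → ℝ}
    (hg : Measurable g) (h : ∀ y, g y ∈ Set.Icc 0 1)
    (hle : ∀ y, a * (signalPDF σ i y * g y) ≤ b * signalPDF σ j y) :
    a * ∫ y, g y ∂signalLaw σ i ≤ b := by
  have hσ2 : σ ^ 2 ≠ 0 := (pow_pos hσ 2).ne'
  rw [signalLaw, integral_gaussianReal_eq_integral_smul hσ2]
  simp only [smul_eq_mul]
  calc a * ∫ y, gaussianPDFReal (hypValue i) (σ ^ 2) y * g y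
      = ∫ y, a * (gaussianPDFReal (hypValue i) (σ ^ 2) y * g y) := (integral_const_mul _ _).symm
    _ ≤ ∫ y, b * gaussianPDFReal (hypValue j) (σ ^ 2) y :=
        integral_mono ((integrable_gaussianPDFReal_mul _ _ hg h).const_mul _)
          ((integrable_gaussianPDFReal _ _).const_mul _) hle
    _ = b := by rw [integral_const_mul, integral_gaussianPDFReal_eq_one _ hσ2, mul_one]

lemma bayesRisk_beliefRules_le {σ : ℝ≥0} (hσ : 0 < σ) {cFA cMD π₀ : ℝ} (hFA : 0 < cFA)
    (hMD : 0 < cMD) (hπ₀ : 0 < π₀) (hπ₁ : π₀ < 1) (N : ℕ) :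
    bayesRisk σ cFA cMD π₀ (beliefRules (N := N) σ cFA cMD (cMD / (cFA + cMD))
      fun _ => cMD / (cFA + cMD))
      ≤ (cFA * π₀ + cMD * (1 - π₀)) * Real.exp (-(N * symExponent (halfDist σ))) := by
  set q := cMD / (cFA + cMD) with hq
  set D := beliefRules (N := N) σ cFA cMD q fun _ => q with hD
  have hmk : IsMarkovKernel (localKernel σ cFA cMD q) := by unfold localKernel; infer_instance
  have := isProbabilityMeasure_localLaw σ (localKernel σ cFA cMD q)
  have := D.fus_markov
  set p : Bool → Bool → ℝ := fun h b => (localLaw σ (localKernel σ cFA cMD q) h).real {b} with hp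
  have hpt : ∀ h, p h true = stdCDF (if h then halfDist σ else -halfDist σ) := fun h =>
    localLaw_localKernel_true hσ hFA hMD h
  have hpf : ∀ h, p h false = stdCDF (if h then -halfDist σ else halfDist σ) := by
    intro h
    have h1 : p h false = 1 - p h true := real_singleton_false
    rw [h1, hpt, ← stdCDF_neg]
    cases h <;> simp
  have hp0 : ∀ h b, 0 < p h b := by
    rintro h (_ | _)
    · rw [hpf]; exact stdCDF_pos _
    · rw [hpt]; exact stdCDF_pos _
  have hsum : ∑ x : Fin N → Bool, min (∏ i, p false (x i)) (∏ i, p true (x i))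
      ≤ Real.exp (-(N * symExponent (halfDist σ))) := by
    refine (sum_min_prod_le _ _ (fun b => (hp0 _ b).le) fun b => (hp0 _ b).le).trans_eq ?_
    rw [neg_mul_eq_mul_neg, Real.exp_nat_mul, exp_neg_symExponent, Fintype.sum_bool, hpt, hpt,
      hpf, hpf]
    congr 1
    simp only [if_true, Bool.false_eq_true, if_false]
    rw [mul_comm (stdCDF (-halfDist σ))]
    ring
  have hdec : ∀ (x : Fin N → Bool) (y : ℝ), fusionDecision σ cFA cMD q (y, x) = true ↔
      (∏ i, p false (x i)) * signalPDF σ false y < (∏ i, p true (x i)) * signalPDF σ true y := by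
    intro x y
    have h0 : 0 < signalPDF σ false y := gaussianPDFReal_pos _ _ _ (pow_pos hσ 2).ne'
    have h1 : 0 < ∏ i, p true (x i) := Finset.prod_pos fun i _ => hp0 _ _
    rw [fusionDecision, threshold_eq_one hFA hMD, one_mul, Finset.prod_div_distrib,
      likelihoodRatio]
    simp only [Bool.if_false_right, Bool.and_true, decide_eq_true_eq]
    rw [div_lt_div_iff₀ h1 h0, mul_comm (signalPDF σ true y)]
  have hfus : ∀ (x : Fin N → Bool) (y : ℝ) b, (D.fus (y, x)).real {b}
      = if fusionDecision σ cFA cMD q (y, x) = b then 1 else 0 := by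
    intro x y b
    rw [hD]
    simp only [beliefRules]
    rw [Kernel.deterministic_apply, dirac_real_singleton]
  have hpdf : ∀ h y, 0 ≤ signalPDF σ h y := fun h y => gaussianPDFReal_nonneg _ _ _
  have hPnn : ∀ h (x : Fin N → Bool), 0 ≤ ∏ i, p h (x i) := fun h x =>
    Finset.prod_nonneg fun i _ => (hp0 _ _).le
  have herr : ∀ h b, h ≠ b → (fusionLaw σ D h).real {b}
      ≤ Real.exp (-(N * symExponent (halfDist σ))) := by
    intro h b hhb
    refine le_trans ?_ hsum
    rw [fusionLaw_real]
    refine Finset.sum_le_sum fun x _ => ?_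
    have hm : Measurable fun y => (D.fus (y, x)).real {b} :=
      (measurable_kernel_real D.fus (measurableSet_singleton b)).comp (by fun_prop)
    have hI : ∀ y, (D.fus (y, x)).real {b} ∈ Set.Icc (0 : ℝ) 1 := fun y =>
      measureReal_mem_Icc _ _
    have hA : (∏ i, p h (x i)) * ∫ y, (D.fus (y, x)).real {b} ∂signalLaw σ h
        ≤ ∏ i, p h (x i) := mul_le_of_le_one_right (hPnn h x) (integral_mem_Icc hm hI).2
    -- Where the test decides b, the joint likelihood under h is at most that under b; integrating
    -- the latter over y leaves the weight of x under b.
    have hB : (∏ i, p h (x i)) * ∫ y, (D.fus (y, x)).real {b} ∂signalLaw σ h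
        ≤ ∏ i, p b (x i) := by
      refine mul_integral_le_of_pointwise (j := b) hσ hm hI fun y => ?_
      rw [hfus]
      split_ifs with hd
      · have := hdec x y
        cases h <;> cases b
        · exact absurd rfl hhb
        · rw [mul_one]
          exact (this.1 hd).le
        · rw [mul_one]
          rw [hd] at this
          exact not_lt.1 fun h => by simpa using this.2 h
        · exact absurd rfl hhb
      · rw [mul_zero, mul_zero]
        exact mul_nonneg (hPnn b x) (hpdf b y)
    cases h <;> cases b
    · exact absurd rfl hhb
    · exact le_min hA hB
    · exact le_min hB hA
    · exact absurd rfl hhb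
  rw [bayesRisk, add_mul]
  have hπ : 0 < 1 - π₀ := by linarith
  exact add_le_add (mul_le_mul_of_nonneg_left (herr false true (by decide)) (by positivity))
    (mul_le_mul_of_nonneg_left (herr true false (by decide)) (by positivity))

/-! ### Risk exponents -/

/-- An upper bound for `riskRate` that holds for all decision rules. -/
def rateBound (σ : ℝ≥0) (cFA cMD π₀ : ℝ) (N : ℕ) : ℝ :=
  symExponent (halfDist σ) + (8 * secondMoment σ + 1) * (√N / N)
    - Real.log (min (cFA * π₀) (cMD * (1 - π₀)) * (3 / (4 * secondMoment σ))) / N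

lemma bayesRisk_pos {σ : ℝ≥0} (hσ : 0 < σ) {cFA cMD π₀ : ℝ} (hFA : 0 < cFA) (hMD : 0 < cMD)
    (hπ₀ : 0 < π₀) (hπ₁ : π₀ < 1) {N : ℕ} (hN : 0 < N) (D : DecisionRules N) :
    0 < bayesRisk σ cFA cMD π₀ D := by
  refine lt_of_lt_of_le ?_ (le_bayesRisk hσ hFA hMD hπ₀ hπ₁ hN D)
  have hm : 0 < min (cFA * π₀) (cMD * (1 - π₀)) :=
    lt_min (by positivity) (mul_pos hMD (by linarith))
  have := one_le_secondMoment σ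
  positivity

lemma riskRate_le {σ : ℝ≥0} (hσ : 0 < σ) {cFA cMD π₀ : ℝ} (hFA : 0 < cFA) (hMD : 0 < cMD)
    (hπ₀ : 0 < π₀) (hπ₁ : π₀ < 1) {N : ℕ} (hN : 0 < N) (D : DecisionRules N) :
    riskRate σ cFA cMD π₀ D ≤ rateBound σ cFA cMD π₀ N := by
  have h := le_bayesRisk hσ hFA hMD hπ₀ hπ₁ hN D
  have hm : 0 < min (cFA * π₀) (cMD * (1 - π₀)) :=
    lt_min (by positivity) (mul_pos hMD (by linarith))
  have hM := one_le_secondMoment σ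
  have hη : 0 < 3 / (4 * secondMoment σ) := by positivity
  have h2 := Real.log_le_log (by positivity) h
  rw [Real.log_mul (by positivity) (Real.exp_pos _).ne', Real.log_exp] at h2
  have hN' : (0 : ℝ) < N := by exact_mod_cast hN
  have h3 := mul_le_mul_of_nonneg_left h2 (inv_pos.2 hN').le
  rw [riskRate, rateBound]
  have e : symExponent (halfDist σ) = (N : ℝ)⁻¹ * (N * symExponent (halfDist σ)) := by
    rw [inv_mul_cancel_left₀ hN'.ne']
  rw [e]
  simp only [div_eq_mul_inv, one_mul] at h3 ⊢
  linarith

lemma tendsto_rateBound (σ : ℝ≥0) (cFA cMD π₀ : ℝ) :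
    Tendsto (rateBound σ cFA cMD π₀) atTop (𝓝 (symExponent (halfDist σ))) := by
  have h1 : Tendsto (fun N : ℕ => √(N : ℝ) / N) atTop (𝓝 0) := by
    have : Tendsto (fun N : ℕ => (√(N : ℝ))⁻¹) atTop (𝓝 0) :=
      tendsto_inv_atTop_zero.comp (Real.tendsto_sqrt_atTop.comp tendsto_natCast_atTop_atTop)
    refine this.congr fun N => ?_
    rw [Real.sqrt_div_self]
  have h2 := tendsto_const_div_atTop_nhds_zero_nat
    (Real.log (min (cFA * π₀) (cMD * (1 - π₀)) * (3 / (4 * secondMoment σ))))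
  have h3 := ((h1.const_mul (8 * secondMoment σ + 1)).const_add (symExponent (halfDist σ))).sub h2
  simp only [mul_zero, add_zero, sub_zero] at h3
  exact h3

lemma tendsto_riskRate_beliefRules {σ : ℝ≥0} (hσ : 0 < σ) {cFA cMD π₀ : ℝ} (hFA : 0 < cFA)
    (hMD : 0 < cMD) (hπ₀ : 0 < π₀) (hπ₁ : π₀ < 1) :
    Tendsto (fun N : ℕ => riskRate σ cFA cMD π₀ (beliefRules (N := N) σ cFA cMD
      (cMD / (cFA + cMD)) fun _ => cMD / (cFA + cMD))) atTop
      (𝓝 (symExponent (halfDist σ))) := by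
  have hK : 0 < cFA * π₀ + cMD * (1 - π₀) :=
    add_pos (mul_pos hFA hπ₀) (mul_pos hMD (by linarith))
  have h1 : Tendsto (fun N : ℕ => symExponent (halfDist σ)
      - Real.log (cFA * π₀ + cMD * (1 - π₀)) / N) atTop (𝓝 (symExponent (halfDist σ))) := by
    simpa using (tendsto_const_div_atTop_nhds_zero_nat
      (Real.log (cFA * π₀ + cMD * (1 - π₀)))).const_sub (symExponent (halfDist σ))
  refine tendsto_of_tendsto_of_tendsto_of_le_of_le' h1 (tendsto_rateBound σ cFA cMD π₀) ?_ ?_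
  · filter_upwards [eventually_gt_atTop 0] with N hN
    have hN' : (0 : ℝ) < N := by exact_mod_cast hN
    have h := Real.log_le_log (bayesRisk_pos hσ hFA hMD hπ₀ hπ₁ hN _)
      (bayesRisk_beliefRules_le hσ hFA hMD hπ₀ hπ₁ N)
    rw [Real.log_mul hK.ne' (Real.exp_pos _).ne', Real.log_exp] at h
    have h3 := mul_le_mul_of_nonneg_left h (inv_pos.2 hN').le
    have e : symExponent (halfDist σ) = (N : ℝ)⁻¹ * (N * symExponent (halfDist σ)) := by
      rw [inv_mul_cancel_left₀ hN'.ne']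
    rw [riskRate, e, div_eq_inv_mul (Real.log _), one_div]
    linarith
  · filter_upwards [eventually_gt_atTop 0] with N hN
    exact riskRate_le hσ hFA hMD hπ₀ hπ₁ hN _

lemma limsup_riskRate_le {σ : ℝ≥0} (hσ : 0 < σ) {cFA cMD π₀ : ℝ} (hFA : 0 < cFA) (hMD : 0 < cMD)
    (hπ₀ : 0 < π₀) (hπ₁ : π₀ < 1) (D : ∀ N : ℕ, DecisionRules N) :
    limsup (fun N : ℕ => (riskRate σ cFA cMD π₀ (D N) : EReal)) atTop
      ≤ (symExponent (halfDist σ) : EReal) := by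
  have h1 : Tendsto (fun N => (rateBound σ cFA cMD π₀ N : EReal)) atTop
      (𝓝 (symExponent (halfDist σ) : EReal)) :=
    (continuous_coe_real_ereal.tendsto _).comp (tendsto_rateBound σ cFA cMD π₀)
  rw [← h1.limsup_eq]
  refine limsup_le_limsup ?_
  filter_upwards [eventually_gt_atTop 0] with N hN
  exact EReal.coe_le_coe_iff.2 (riskRate_le hσ hFA hMD hπ₀ hπ₁ hN _)

lemma optimalRiskExponent_eq {σ : ℝ≥0} (hσ : 0 < σ) {cFA cMD π₀ : ℝ} (hFA : 0 < cFA)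
    (hMD : 0 < cMD) (hπ₀ : 0 < π₀) (hπ₁ : π₀ < 1) :
    optimalRiskExponent σ cFA cMD π₀ = (symExponent (halfDist σ) : EReal) := by
  refine le_antisymm (sSup_le ?_) (le_sSup ?_)
  · rintro β ⟨D, hD⟩
    rw [← hD.limsup_eq]
    exact limsup_riskRate_le hσ hFA hMD hπ₀ hπ₁ D
  · exact ⟨_, (continuous_coe_real_ereal.tendsto _).comp
      (tendsto_riskRate_beliefRules hσ hFA hMD hπ₀ hπ₁)⟩

/-! ### The value of the exponent -/

/-- The two laws are mirror images, so the two summands have a product independent of s; by AM–GM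
their sum is least at s = 1/2, where they coincide. -/
lemma chernoffInfo_bernQ (x : ℝ) : chernoffInfo (bernQ x) (bernQ (-x)) = symExponent x := by
  have hprob : ∀ y, IsProbabilityMeasure (bernQ y) := fun y => by unfold bernQ; infer_instance
  have ht : ∀ y, (bernQ y).real {true} = stdCDF (-y) := fun y => by
    rw [bernQ, bernoulli_real_true, stdCDF, neg_neg]
  have hf : ∀ y, (bernQ y).real {false} = stdCDF y := fun y => by
    rw [real_singleton_false, ht, ← stdCDF_neg, neg_neg]
  have ha := stdCDF_pos x
  have hb := stdCDF_pos (-x)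
  have key : IsLeast ((fun s : ℝ => Real.log (∑ b, (bernQ x).real {b} ^ s
      * (bernQ (-x)).real {b} ^ (1 - s))) '' Set.Icc 0 1) (-symExponent x) := by
    have hsq : ∀ a b : ℝ, 0 < a → 0 < b → √(a * b) = a ^ (1 / 2 : ℝ) * b ^ (1 / 2 : ℝ) := by
      intro a b ha hb
      rw [Real.sqrt_eq_rpow, Real.mul_rpow ha.le hb.le]
    have he := exp_neg_symExponent x
    rw [hsq _ _ ha hb] at he
    simp only [Fintype.sum_bool, ht, hf, neg_neg]
    constructor
    · refine ⟨1 / 2, by norm_num, ?_⟩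
      simp only
      rw [show (1 : ℝ) - 1 / 2 = 1 / 2 by norm_num, ← Real.log_exp (-symExponent x), he]
      congr 1
      ring
    · rintro _ ⟨s, -, rfl⟩
      simp only
      rw [Real.le_log_iff_exp_le (by positivity), exp_neg_symExponent]
      have h1 : ∀ a b : ℝ, 0 < a → 0 < b → 2 * √(a * b) ≤ a + b := by
        intro a b ha hb
        rw [Real.sqrt_mul ha.le]
        nlinarith [sq_nonneg (√a - √b), Real.sq_sqrt ha.le, Real.sq_sqrt hb.le]
      refine le_trans (le_of_eq ?_) (h1 _ _ (by positivity) (by positivity))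
      congr 2
      rw [mul_mul_mul_comm, mul_comm (stdCDF x ^ (1 - s)), mul_mul_mul_comm, ← Real.rpow_add hb,
        mul_comm (stdCDF x ^ s), ← Real.rpow_add ha]
      simp [mul_comm]
  rw [chernoffInfo, key.csInf_eq, neg_neg]

/-! ### Numerical evaluation at `σ = 1`. -/

lemma cubic_le_exp_neg {w : ℝ} (hw : 0 ≤ w) :
    1 - w + w ^ 2 / 2 - w ^ 3 / 6 ≤ Real.exp (-w) := by
  set F : ℝ → ℝ := fun w => Real.exp (-w) - (1 - w + w ^ 2 / 2 - w ^ 3 / 6) with hF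
  have hd : ∀ w, HasDerivAt F (-Real.exp (-w) + (1 - w + w ^ 2 / 2)) w := by
    intro w
    have h1 : HasDerivAt (fun w : ℝ => Real.exp (-w)) (-Real.exp (-w)) w := by
      simpa using (hasDerivAt_neg w).exp
    have h2 := (((hasDerivAt_id w).const_sub 1).add ((hasDerivAt_pow 2 w).div_const 2)).sub
      ((hasDerivAt_pow 3 w).div_const 6)
    refine (h1.sub h2).congr_deriv ?_
    norm_num
    ring
  have hm : MonotoneOn F (Set.Ici 0) := by
    refine monotoneOn_of_deriv_nonneg (convex_Ici 0)
      (fun x _ => (hd x).continuousAt.continuousWithinAt)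
      (fun x _ => (hd x).differentiableAt.differentiableWithinAt) fun x hx => ?_
    rw [interior_Ici] at hx
    rw [(hd x).deriv]
    linarith [exp_neg_le_quadratic (le_of_lt hx)]
  have := hm Set.self_mem_Ici hw hw
  simp only [hF] at this
  norm_num at this
  linarith

lemma taylor_le_cdfDev {x : ℝ} (hx : 0 ≤ x) :
    stdPDF 0 * (x - x ^ 3 / 6 + x ^ 5 / 40 - x ^ 7 / 336) ≤ cdfDev x := by
  set F : ℝ → ℝ := fun x => cdfDev x - stdPDF 0 * (x - x ^ 3 / 6 + x ^ 5 / 40 - x ^ 7 / 336)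
    with hF
  have hd : ∀ x, HasDerivAt F
      (stdPDF x - stdPDF 0 * (1 - x ^ 2 / 2 + x ^ 4 / 8 - x ^ 6 / 48)) x := by
    intro x
    have h1 : HasDerivAt (fun x : ℝ => x - x ^ 3 / 6 + x ^ 5 / 40 - x ^ 7 / 336)
        (1 - x ^ 2 / 2 + x ^ 4 / 8 - x ^ 6 / 48) x := by
      refine ((((hasDerivAt_id x).sub ((hasDerivAt_pow 3 x).div_const 6)).add
        ((hasDerivAt_pow 5 x).div_const 40)).sub
        ((hasDerivAt_pow 7 x).div_const 336)).congr_deriv ?_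
      norm_num
      ring
    exact (hasDerivAt_cdfDev x).sub (h1.const_mul _)
  have hmono : Monotone F := by
    refine monotone_of_deriv_nonneg (fun x => (hd x).differentiableAt) fun x => ?_
    rw [(hd x).deriv, stdPDF_eq_zero_mul x, ← mul_sub]
    refine mul_nonneg (stdPDF_pos 0).le ?_
    have := cubic_le_exp_neg (w := x ^ 2 / 2) (by positivity)
    rw [show -x ^ 2 / 2 = -(x ^ 2 / 2) by ring]
    linarith
  have := hmono hx
  simp only [hF, cdfDev_zero] at this
  linarith

lemma symExponent_eq_log (x : ℝ) :
    symExponent x = -(1 / 2) * Real.log (1 - 4 * cdfDev x ^ 2) := by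
  have h : 1 - 4 * cdfDev x ^ 2 = 2 ^ 2 * (stdCDF x * stdCDF (-x)) := by
    rw [stdCDF_mul_neg]
    ring
  rw [h, Real.log_mul (by norm_num) (mul_pos (stdCDF_pos x) (stdCDF_pos (-x))).ne',
    Real.log_mul (stdCDF_pos x).ne' (stdCDF_pos _).ne', Real.log_pow, symExponent]
  push_cast
  ring

lemma abs_symExponent_half_sub_lt : |symExponent (1 / 2) - 0.0793| < 0.00005 := by
  have hφ := stdPDF_pos 0
  have hP := cdfDev_pos (x := 1 / 2) (by norm_num)
  have hu := cdfDev_le_taylor (x := 1 / 2) (by norm_num)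
  have hl := taylor_le_cdfDev (x := 1 / 2) (by norm_num)
  have hκu : stdPDF 0 ^ 2 ≤ 0.1591550 := by
    rw [stdPDF_zero_sq, div_le_iff₀ (by positivity)]
    nlinarith [Real.pi_gt_d6]
  have hκl : 0.1591549 ≤ stdPDF 0 ^ 2 := by
    rw [stdPDF_zero_sq, le_div_iff₀ (by positivity)]
    nlinarith [Real.pi_lt_d6]
  norm_num at hu hl
  have hu2 := pow_le_pow_left₀ hP.le hu 2
  have hl2 := pow_le_pow_left₀ (by positivity) hl 2
  rw [mul_pow] at hu2 hl2
  have hX1 : 1 - 4 * cdfDev (1 / 2) ^ 2 < 0.85339 := by norm_num at hl2 ⊢; linarith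
  have hX2 : 0.85335 < 1 - 4 * cdfDev (1 / 2) ^ 2 := by norm_num at hu2 ⊢; linarith
  -- The bounds -0.1585 and -0.1587 on the logarithm are -2 (0.0793 ∓ 0.00005).
  have hlog1 : Real.log (1 - 4 * cdfDev (1 / 2) ^ 2) < -0.1585 := by
    rw [Real.log_lt_iff_lt_exp (by linarith)]
    have := cubic_le_exp_neg (w := 0.1585) (by norm_num)
    norm_num at this hX1 ⊢
    linarith
  have hlog2 : -0.1587 < Real.log (1 - 4 * cdfDev (1 / 2) ^ 2) := by
    rw [Real.lt_log_iff_exp_lt (by linarith)]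
    refine lt_of_le_of_lt ?_ hX2
    have := Real.sum_le_exp_of_nonneg (x := 0.1587) (by norm_num) 4
    simp only [Finset.sum_range_succ, Finset.sum_range_zero, Nat.factorial] at this
    rw [Real.exp_neg, inv_le_comm₀ (Real.exp_pos _) (by norm_num)]
    refine le_trans ?_ this
    norm_num
  rw [symExponent_eq_log, abs_lt]
  constructor <;> linarith

end StarNetwork

end

theorem mainTheorem3 (σ : ℝ≥0) (hσ : 0 < σ) (cFA cMD : ℝ) (hFA : 0 < cFA) (hMD : 0 < cMD)
    (π₀ : ℝ) (hπ₀ : 0 < π₀) (hπ₁ : π₀ < 1) :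
    -- With the belief `c_MD / (c_FA + c_MD)` a local agent decides `1` exactly when `y > 1/2`.
    (∀ y : ℝ, StarNetwork.localDecision σ cFA cMD (cMD / (cFA + cMD)) y = true ↔ 1 / 2 < y) ∧
    -- Giving this belief to all agents attains the optimal risk exponent, as a limit.
    Tendsto (fun N : ℕ => (StarNetwork.riskRate σ cFA cMD π₀ (StarNetwork.beliefRules (N := N)
        σ cFA cMD (cMD / (cFA + cMD)) (fun _ => cMD / (cFA + cMD))) : EReal))
      atTop (𝓝 (StarNetwork.optimalRiskExponent σ cFA cMD π₀)) ∧
    -- No decision rules do better, even along a subsequence.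
    (∀ D : ∀ N : ℕ, StarNetwork.DecisionRules N,
      limsup (fun N : ℕ => (StarNetwork.riskRate σ cFA cMD π₀ (D N) : EReal)) atTop
        ≤ StarNetwork.optimalRiskExponent σ cFA cMD π₀) ∧
    -- The value of the optimal risk exponent.
    StarNetwork.optimalRiskExponent σ cFA cMD π₀ =
      (StarNetwork.chernoffInfo (StarNetwork.bernQ (0.5 / σ)) (StarNetwork.bernQ (-0.5 / σ)) : ℝ) ∧
    (σ = 1 → |StarNetwork.chernoffInfo (StarNetwork.bernQ (0.5 / σ)) (StarNetwork.bernQ (-0.5 / σ))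
      - 0.0793| < 0.00005) := by
  have hhalf : (0.5 : ℝ) / σ = StarNetwork.halfDist σ := by
    rw [StarNetwork.halfDist, ← div_div]
    norm_num
  rw [neg_div, hhalf, StarNetwork.chernoffInfo_bernQ,
    StarNetwork.optimalRiskExponent_eq hσ hFA hMD hπ₀ hπ₁]
  refine ⟨StarNetwork.localDecision_eq_true_iff hσ hFA hMD,
    (continuous_coe_real_ereal.tendsto _).comp
      (StarNetwork.tendsto_riskRate_beliefRules hσ hFA hMD hπ₀ hπ₁),
    StarNetwork.limsup_riskRate_le hσ hFA hMD hπ₀ hπ₁, rfl, ?_⟩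
  rintro rfl
  have : StarNetwork.halfDist 1 = 1 / 2 := by
    rw [StarNetwork.halfDist]
    norm_num
  rw [this]
  exact StarNetwork.abs_symExponent_half_sub_lt
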